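/- A clutter $\mathcal C$ is a family of subsets (members) of a finite ground set $V$, none of which contains another. A cover is a subset of $V$ meeting every member; the minimal covers form the blocker $b(\mathcal C)$, and the covering number is the minimum cardinality of a cover. For disjoint $I,J\subseteq V$, the minor $\mathcal C\setminus I/J$ is the clutter over $V\setminus(I\cup J)$ whose members are the inclusion-wise minimal sets among $\{A\setminus J : A\in\mathcal C,\ A\cap I=\emptyset\}$. A delta is a clutter over $\{a_1,\dots,a_n\}$, $n\ge 3$, with members $\{a_2,\dots,a_n\}$ and $\{a_1,a_i\}$, $i=2,\dots,n$. An extended odd hole is a clutter over $\{a_1,\dots,a_n\}$, $n\ge 5$ odd, whose minimum cardinality members are exactly $\{a_1,a_2\},\dots,\{a_{n-1},a_n\},\{a_n,a_1\}$. A clutter is clean if it has no minor that is a delta or the blocker of an extended odd hole, and tangled if its covering number is two and every element of $V$ belongs to a minimum cover. Let $\mathcal C$ be a clean tangled clutter over $V$. Let $G(\mathcal C)$ be the graph on $V$ whose edges are the minimum covers, and let the rank $r$ of $\mathcal C$ be the number of connected components of $G(\mathcal C)$. A fractional packing is a vector $y\in\mathbb R^{\mathcal C}_{\ge 0}$ with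 $\sum_{A\in\mathcal C,\,v\in A}y_A\le 1$ for all $v\in V$; its value is $\sum_A y_A$. The core of $\mathcal C$ is the clutter over $V$ of those $A\in\mathcal C$ with $y_A>0$ for some fractional packing $y$ of value two. For $S\subseteq\{0,1\}^n$, $\mathrm{cuboid}(S)$ is the clutter over $\{1,\dots,2n\}$ whose members have incidence vectors $(p_1,1-p_1,\dots,p_n,1-p_n)$, $p\in S$. A duplication of a clutter is obtained, up to relabeling, by replacing each element by one or more copies of it. A setcore of $\mathcal C$ is a set $S\subseteq\{0,1\}^r$ such that the core of $\mathcal C$ is a duplication of $\mathrm{cuboid}(S)$. For $k\ge 1$, let $A_k$ be the $k\times(2^k-1)$ matrix over $GF(2)$ whose columns are all the nonzero vectors; it represents the projective geometry $PG(k-1,2)$, whose cocycle space $\mathrm{cocycle}(PG(k-1,2))\subseteq\{0,1\}^{2^k-1}$ is the row space of $A_k$ over $GF(2)$. Two sets of $0$-$1$ points are isomorphic if one is obtained from the other by relabeling coordinates and twisting some of them, i.e. replacing $x_i$ by $1-x_i$. Theorem. Let $\mathcal C$ be a clean tangled clutter. Then $\mathcal C$ has a setcore and, for every setcore $S$ of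 $\mathcal C$, the polytope $\mathrm{conv}(S)\subseteq\mathbb R^r$ is a simplex (the convex hull of affinely independent points) if, and only if, for some integer $k\ge 1$, $S$ is isomorphic to $\mathrm{cocycle}(PG(k-1,2))$. -/

import Mathlib

open Finset

/-- A clutter: a finite ground set with a family of subsets of it (the members), none of which
contains another one. -/
structure Clutter (α : Type*) where
  ground : Finset α
  members : Finset (Finset α)
  subset_ground : ∀ A ∈ members, A ⊆ ground
  antichain : ∀ A ∈ members, ∀ B ∈ members, A ⊆ B → A = B

/-- The inclusion-wise minimal sets of a finite family. -/
def minimalSets {α : Type*} [DecidableEq α] (F : Finset (Finset α)) : Finset (Finset α) :=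
  F.filter (fun A => ∀ B ∈ F, B ⊆ A → B = A)

namespace Clutter

section Basic

variable {α : Type*} [DecidableEq α]

/-- `C.minor I J` is the clutter obtained from `C` by deleting `I` and contracting `J`
(meant for disjoint subsets `I`, `J` of the ground set). -/
def minor (C : Clutter α) (I J : Finset α) : Clutter α where
  ground := C.ground \ (I ∪ J)
  members := minimalSets ((C.members.filter (fun A => A ∩ I = ∅)).image (fun A => A \ J))
  subset_ground := by
    intro A hA
    obtain ⟨B, hB, rfl⟩ := mem_image.1 (mem_filter.1 hA).1
    obtain ⟨hBC, hBI⟩ := mem_filter.1 hB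
    intro v hv
    obtain ⟨hvB, hvJ⟩ := mem_sdiff.1 hv
    refine mem_sdiff.2 ⟨C.subset_ground B hBC hvB, fun h => ?_⟩
    rcases mem_union.1 h with h | h
    · have : v ∈ B ∩ I := mem_inter.2 ⟨hvB, h⟩
      rw [hBI] at this
      exact notMem_empty v this
    · exact hvJ h
  antichain := by
    intro A hA B hB hAB
    exact (mem_filter.1 hB).2 A (mem_filter.1 hA).1 hAB

/-- A cover: a set of elements that intersects every member at least once. -/
def IsCover (C : Clutter α) (B : Finset α) : Prop :=
  B ⊆ C.ground ∧ ∀ A ∈ C.members, (A ∩ B).Nonempty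

instance (C : Clutter α) : DecidablePred C.IsCover :=
  fun B => inferInstanceAs (Decidable (B ⊆ C.ground ∧ ∀ A ∈ C.members, (A ∩ B).Nonempty))

/-- The blocker: the clutter of the minimal covers, over the same ground set. -/
def blocker (C : Clutter α) : Clutter α where
  ground := C.ground
  members := minimalSets (C.ground.powerset.filter C.IsCover)
  subset_ground := by
    intro A hA
    exact mem_powerset.1 (mem_filter.1 (mem_filter.1 hA).1).1
  antichain := by
    intro A hA B hB hAB
    exact (mem_filter.1 hB).2 A (mem_filter.1 hA).1 hAB

/-- A delta: at least three elements `a₁, …, aₙ`, with members `{a₂, …, aₙ}` and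
`{a₁, aᵢ}` for `i = 2, …, n`. -/
def IsDelta (C : Clutter α) : Prop :=
  3 ≤ C.ground.card ∧ ∃ a ∈ C.ground,
    C.members = insert (C.ground.erase a) ((C.ground.erase a).image (fun b => {a, b}))

/-- An extended odd hole: the ground set can be cyclically ordered as `a₁, …, aₙ` with `n ≥ 5` odd
such that the members of minimum cardinality are exactly `{a₁, a₂}, …, {aₙ₋₁, aₙ}, {aₙ, a₁}`. -/
def IsExtendedOddHole (C : Clutter α) : Prop :=
  ∃ n : ℕ, 5 ≤ n ∧ Odd n ∧ ∃ a : ZMod n → α,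
    Function.Injective a ∧ Set.range a = (C.ground : Set α) ∧
    ∀ A : Finset α, (A ∈ C.members ∧ ∀ B ∈ C.members, A.card ≤ B.card) ↔
      ∃ i : ZMod n, A = {a i, a (i + 1)}

/-- A clutter is clean if it has no minor that is a delta or the blocker of an extended odd
hole. -/
def IsClean (C : Clutter α) : Prop :=
  ∀ I J : Finset α, I ⊆ C.ground → J ⊆ C.ground → Disjoint I J →
    ¬ (C.minor I J).IsDelta ∧
    ¬ ∃ E : Clutter α, E.IsExtendedOddHole ∧ C.minor I J = E.blocker

/-- The covering number: the minimum cardinality of a cover. (A clutter without covers, i.e. with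
`∅` as its member, gets the value `0`.) -/
noncomputable def coveringNumber (C : Clutter α) : ℕ :=
  sInf {n | ∃ B : Finset α, C.IsCover B ∧ B.card = n}

/-- A minimum cover: a cover of minimum cardinality. -/
def IsMinimumCover (C : Clutter α) (B : Finset α) : Prop :=
  C.IsCover B ∧ B.card = C.coveringNumber

/-- A clutter is tangled if its covering number is two and every element belongs to a minimum
cover. -/
def IsTangled (C : Clutter α) : Prop :=
  C.coveringNumber = 2 ∧ ∀ v ∈ C.ground, ∃ B : Finset α, C.IsMinimumCover B ∧ v ∈ B

/-- The graph on the ground set whose edges are the minimum covers (of cardinality two). -/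
def coverGraph (C : Clutter α) : SimpleGraph C.ground where
  Adj u v := u ≠ v ∧ C.IsMinimumCover {(u : α), (v : α)}
  symm := ⟨fun u v h => ⟨h.1.symm, by rw [Finset.pair_comm]; exact h.2⟩⟩
  loopless := ⟨fun _ h => h.1 rfl⟩

/-- The rank of a clean tangled clutter: the number of connected components of its graph. -/
noncomputable def rank (C : Clutter α) : ℕ :=
  Nat.card C.coverGraph.ConnectedComponent

/-- `y` is a fractional packing of `C`: nonnegative weights on the members such that every element
receives total weight at most one. Only the values of `y` on members of `C` matter. -/
def IsFractionalPacking (C : Clutter α) (y : Finset α → ℝ) : Prop :=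
  (∀ A ∈ C.members, 0 ≤ y A) ∧
    ∀ v ∈ C.ground, ∑ A ∈ C.members with v ∈ A, y A ≤ 1

/-- The value of a fractional packing. -/
def packingValue (C : Clutter α) (y : Finset α → ℝ) : ℝ :=
  ∑ A ∈ C.members, y A

open Classical in
/-- The core: the clutter, over the same ground set, of the members that receive positive weight
in some fractional packing of value two. -/
noncomputable def core (C : Clutter α) : Clutter α where
  ground := C.ground
  members := C.members.filter (fun A =>
    ∃ y : Finset α → ℝ, C.IsFractionalPacking y ∧ C.packingValue y = 2 ∧ 0 < y A)
  subset_ground := fun A hA => C.subset_ground A (mem_filter.1 hA).1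
  antichain := fun A hA B hB h =>
    C.antichain A (mem_filter.1 hA).1 B (mem_filter.1 hB).1 h

/-- `D.IsDuplication C`: up to relabeling, `D` is obtained from `C` by duplicating some elements.
The map `φ` sends every element of `D` to the element of `C` that it is a copy of; every element
of `C` has at least one copy, and the members of `D` are obtained from those of `C` by replacing
each element by all of its copies. -/
def IsDuplication {β : Type*} [DecidableEq β] (D : Clutter α) (C : Clutter β) : Prop :=
  ∃ φ : α → β, D.ground.image φ = C.ground ∧
    D.members = C.members.image (fun B => D.ground.filter (fun v => φ v ∈ B))

end Basic

/-- The cuboid of `S ⊆ {0,1}ⁿ`. Its `2n` elements are the pairs `(i, b)` with `b ∈ {0,1}`, and the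
member given by `p ∈ S` is `{(i, p i) : i}`; so `(i, 1)` and `(i, 0)` are the elements `2i - 1` and
`2i` of the description by incidence vectors `(p₁, 1 - p₁, …, pₙ, 1 - pₙ)`. -/
def cuboid {n : ℕ} (S : Finset (Fin n → ZMod 2)) : Clutter (Fin n × ZMod 2) where
  ground := univ
  members := S.image (fun p => univ.image (fun i => (i, p i)))
  subset_ground := fun _ _ => subset_univ _
  antichain := by
    intro A hA B hB h
    obtain ⟨p, -, rfl⟩ := mem_image.1 hA
    obtain ⟨q, -, rfl⟩ := mem_image.1 hB
    have hpq : p = q := by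
      funext i
      obtain ⟨j, -, hj⟩ := mem_image.1 (h (mem_image_of_mem (fun i => (i, p i)) (mem_univ i)))
      simp only [Prod.mk.injEq] at hj
      obtain ⟨rfl, hj⟩ := hj
      exact hj.symm
    rw [hpq]

/-- `S` is (a representative of) the setcore of `C`: a set `S ⊆ {0,1}ʳ`, with `r` the rank of `C`,
such that the core of `C` is a duplication of the cuboid of `S`. -/
def IsSetcore {α : Type*} [DecidableEq α] (C : Clutter α)
    (S : Finset (Fin C.rank → ZMod 2)) : Prop :=
  C.core.IsDuplication (cuboid S)

end Clutter

/-- Two sets of `0-1` points are isomorphic if one is obtained from the other after relabeling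
(`e`) and twisting (`q`) some coordinates. -/
def PointsIsomorphic {ι κ : Type*} [DecidableEq κ] [Fintype κ]
    (S : Finset (ι → ZMod 2)) (T : Finset (κ → ZMod 2)) : Prop :=
  ∃ (e : ι ≃ κ) (q : κ → ZMod 2), T = S.image (fun p j => p (e.symm j) + q j)

/-- A `0-1` point as a real vector. -/
def toRealPoint {ι : Type*} (p : ι → ZMod 2) : ι → ℝ :=
  fun i => ((p i).val : ℝ)

/-- The convex hull in `ℝⁿ` of a set of `0-1` points. -/
def convPoints {ι : Type*} (S : Finset (ι → ZMod 2)) : Set (ι → ℝ) :=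
  convexHull ℝ (toRealPoint '' (S : Set (ι → ZMod 2)))

/-- A simplex: the convex hull of `m + 1` affinely independent points, for some `m`. -/
def IsSimplex {ι : Type*} (P : Set (ι → ℝ)) : Prop :=
  ∃ (m : ℕ) (s : Affine.Simplex ℝ (ι → ℝ) m), P = convexHull ℝ (Set.range s.points)

/-- The `k × (2ᵏ - 1)` matrix over `GF(2)` whose columns are the nonzero vectors; it represents the
binary matroid `PG(k-1, 2)`. -/
def pgMatrix (k : ℕ) : Matrix (Fin k) {a : Fin k → ZMod 2 // a ≠ 0} (ZMod 2) :=
  Matrix.of (fun i a => a.1 i)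

/-- The cocycle space of the binary matroid represented by `A`: the row space of `A`. -/
def cocycleSpace {m n : Type*} [Fintype m] [DecidableEq m] [Fintype n] [DecidableEq n]
    (A : Matrix m n (ZMod 2)) : Finset (n → ZMod 2) :=
  univ.image (fun y : m → ZMod 2 => A.transpose.mulVec y)

/-!
Write `G` for the graph of the minimum covers of a clean tangled clutter `C`.

**Fractional packings.** In a clean clutter an odd closed walk of two-element covers is impossible
(`CleanOn.no_odd_closed_walk`), so `G` is bipartite; and a colour class of a component of `G`,
possibly with one more element, is never a cover (`CleanOn.not_cover_colour_class`, which rests on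
the structure `CleanOn.exists_link` of covers that differ from a minimal one by one new element).
Hence, if `U`, `U'` are the colour classes of a component, deleting one and contracting the
other yields a clean clutter that is tangled or has empty ground set (`exists_isSplit`). By
induction both minors have a fractional packing of value two, and so does `C`, by averaging their
lifts (`exists_isPackingTwo`). By complementary slackness a core member meets each edge of `G`
once, so it consists of one colour class of each component; this gives the canonical setcore
(`exists_isSetcore`).

**Convexity.** The lift of a packing from one of the two minors says, for a setcore `S`, that the
point with one coordinate `0` or `1` and all others `1/2` lies in `conv(S)` (`HasFacetCenters`).
Consequently `conv(S)` is full-dimensional, and coordinates of an arbitrary setcore correspond to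
the components of `G` (`CoreCoordinates.coord_eq_of_conn`).

**From simplices to cocycle spaces.** If `conv(S)` is a simplex, the points of `S` are affinely
independent, the packing of value two is unique, and for the corresponding probability weights
on `S` the coordinates are pairwise independent fair bits. Every function on `S` is then affine; doing
this with the product of the signs of two coordinates `i`, `j` shows that in the minor fixing `i`
the component `j` merges with some other component `l` (`merge_or_exists_isBalancedOutside`), and
then `x l = x i + x j` up to a constant (`exists_eq_add_of_signIndependent`). So, after a twist, the
coordinate functions are the nonzero elements of a space of functions over `GF(2)`, and comparing
cardinalities identifies `S` with the row space of `pgMatrix k` (`pointsIsomorphic_cocycleSpace`).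

**From cocycle spaces to simplices.** The `±1` vectors of a cocycle space of a projective geometry
are, with an additional coordinate `1`, the rows of a character table, which is invertible
(`signIndependent_of_pointsIsomorphic`).
-/

/-! ### Odd closed walks and links in clean clutters -/

section CoverPredicates

variable {α : Type*} [DecidableEq α]

/-- An abstract form of cleanness for a monotone predicate `P` on finite sets, to be thought of as
"is a cover", over the ground set `V`. Fixing `I` inside every set and ignoring the elements outside
`I ∪ Y ∪ {a}` does not yield the covers of a delta. Fixing `I` and ignoring the elements outside `I`
and the range of `a` does not leave an odd cycle of length at least five as the graph of two-element
covers, without smaller covers; this is the situation in the blocker of an extended odd hole. -/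
structure CleanOn (P : Finset α → Prop) (V : Finset α) : Prop where
  mono : ∀ X Y, X ⊆ Y → P X → P Y
  delta : ∀ (I Y : Finset α) (a : α), I ⊆ V → Y ⊆ V → a ∈ V → a ∉ I → a ∉ Y → Disjoint I Y →
    2 ≤ Y.card →
    ¬ ∀ X ⊆ insert a Y, P (X ∪ I) ↔ ((a ∈ X ∧ (X ∩ Y).Nonempty) ∨ Y ⊆ X)
  hole : ∀ (I : Finset α) (n : ℕ) (a : ZMod n → α), I ⊆ V → 5 ≤ n → Odd n →
    Function.Injective a → (∀ i, a i ∈ V) → (∀ i, a i ∉ I) → (∀ i, ¬ P ({a i} ∪ I)) →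
    ¬ ∀ i j, i ≠ j → (P ({a i, a j} ∪ I) ↔ (j = i + 1 ∨ i = j + 1))

namespace CleanOn

variable {P : Finset α → Prop} {V : Finset α}

theorem shift (h : CleanOn P V) {J : Finset α} (hJ : J ⊆ V) :
    CleanOn (fun X => P (X ∪ J)) (V \ J) where
  mono X Y hXY := h.mono _ _ (union_subset_union_left hXY)
  delta I Y a hI hY ha haI haY hIY hc hall := by
    refine h.delta (I ∪ J) Y a (union_subset (hI.trans sdiff_subset) hJ) (hY.trans sdiff_subset)
      (mem_sdiff.1 ha).1 ?_ haY ?_ hc ?_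
    · rw [mem_union]
      exact fun h => h.elim haI (mem_sdiff.1 ha).2
    · rw [disjoint_union_left]
      exact ⟨hIY, (disjoint_of_subset_left hY sdiff_disjoint).symm⟩
    · intro X hX
      rw [← union_assoc]
      exact hall X hX
  hole I n a hI hn ho hinj haV haI hs hall := by
    refine h.hole (I ∪ J) n a (union_subset (hI.trans sdiff_subset) hJ) hn ho hinj
      (fun i => (mem_sdiff.1 (haV i)).1) ?_ ?_ ?_
    · intro i
      rw [mem_union]
      exact fun h => h.elim (haI i) (mem_sdiff.1 (haV i)).2
    · intro i
      rw [← union_assoc]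
      exact hs i
    · intro i j hij
      rw [← union_assoc]
      exact hall i j hij

/-- A shortest odd closed walk of two-element covers is an induced odd cycle, hence gives a delta
(a triangle) or the blocker of an extended odd hole. -/
theorem no_odd_closed_walk (h : CleanOn P V) (n : ℕ) (hn : Odd n) (w : ℕ → α)
    (hV : ∀ i ≤ n, w i ∈ V) (hs : ∀ i ≤ n, ¬ P {w i}) (hc : w n = w 0)
    (hw : ∀ i < n, P {w i, w (i + 1)}) : False := by
  induction n using Nat.strong_induction_on generalizing w with
  | _ n ih =>
  have hsplit : ∀ i j, i < j → j < n → w i ≠ w j := by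
    intro i j hij hj he
    rcases Nat.even_or_odd (j - i) with hev | hod
    · refine ih (n - (j - i)) (by omega) ?_ (fun t => if t ≤ i then w t else w (t + (j - i)))
        ?_ ?_ ?_ ?_
      · grind
      · intro t ht
        split_ifs
        · exact hV _ (by omega)
        · exact hV _ (by omega)
      · intro t ht
        split_ifs
        · exact hs _ (by omega)
        · exact hs _ (by omega)
      · rw [if_neg (by omega), if_pos (by omega), show n - (j - i) + (j - i) = n by omega, hc]
      · intro t ht
        rcases lt_trichotomy t i with h1 | h1 | h1
        · rw [if_pos (by omega), if_pos (by omega)]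
          exact hw t (by omega)
        · rw [if_pos (by omega), if_neg (by omega), h1, he,
            show i + 1 + (j - i) = j + 1 by omega]
          exact hw j hj
        · rw [if_neg (by omega), if_neg (by omega), show t + 1 + (j - i) = t + (j - i) + 1 by omega]
          exact hw _ (by omega)
    · refine ih (j - i) (by omega) hod (fun t => w (i + t)) ?_ ?_ ?_ ?_
      · intro t ht
        exact hV _ (by omega)
      · intro t ht
        exact hs _ (by omega)
      · rw [show i + (j - i) = j by omega, Nat.add_zero, he]
      · intro t ht
        exact hw _ (by omega)
  have hchord : ∀ i j, i + 1 < j → j < n → ¬ (i = 0 ∧ j = n - 1) → ¬ P {w i, w j} := by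
    intro i j hij hj hne he
    rcases Nat.even_or_odd (j - i) with hev | hod
    · refine ih (j - i + 1) (by omega) hev.add_one (fun t => if t ≤ j - i then w (i + t) else w i)
        ?_ ?_ ?_ ?_
      · intro t ht
        split_ifs
        · exact hV _ (by omega)
        · exact hV _ (by omega)
      · intro t ht
        split_ifs
        · exact hs _ (by omega)
        · exact hs _ (by omega)
      · rw [if_neg (by omega), if_pos (by omega), Nat.add_zero]
      · intro t ht
        rw [if_pos (by omega)]
        split_ifs
        · exact hw _ (by omega)
        · rw [show i + t = j by omega, pair_comm]
          exact he
    · refine ih (n - (j - i) + 1) (by omega) ?_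
        (fun t => if t ≤ i then w t else w (t + (j - i) - 1)) ?_ ?_ ?_ ?_
      · grind
      · intro t ht
        split_ifs
        · exact hV _ (by omega)
        · exact hV _ (by omega)
      · intro t ht
        split_ifs
        · exact hs _ (by omega)
        · exact hs _ (by omega)
      · rw [if_neg (by omega), if_pos (by omega),
          show n - (j - i) + 1 + (j - i) - 1 = n by omega, hc]
      · intro t ht
        rcases lt_trichotomy t i with h1 | h1 | h1
        · rw [if_pos (by omega), if_pos (by omega)]
          exact hw t (by omega)
        · rw [if_pos (by omega), if_neg (by omega), h1, show i + 1 + (j - i) - 1 = j by omega]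
          exact he
        · rw [if_neg (by omega), if_neg (by omega),
            show t + 1 + (j - i) - 1 = t + (j - i) - 1 + 1 by omega]
          exact hw _ (by omega)
  obtain ⟨k, rfl⟩ := hn
  obtain rfl | rfl | hk : k = 0 ∨ k = 1 ∨ 2 ≤ k := by omega
  · have := hw 0 (by omega)
    simp only [Nat.mul_zero, Nat.zero_add] at hc this
    rw [hc, pair_eq_singleton] at this
    exact hs 0 (by omega) this
  · have h01 := hsplit 0 1 (by omega) (by omega)
    have h02 := hsplit 0 2 (by omega) (by omega)
    have h12 := hsplit 1 2 (by omega) (by omega)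
    have e01 := hw 0 (by omega)
    have e12 := hw 1 (by omega)
    have e20 := hw 2 (by omega)
    norm_num at hc e01 e12 e20
    rw [hc] at e20
    refine h.delta ∅ {w 1, w 2} (w 0) (empty_subset _) ?_ (hV 0 (by omega)) (notMem_empty _) ?_
      (disjoint_empty_left _) (by rw [card_pair h12]) ?_
    · intro x hx
      rw [mem_insert, mem_singleton] at hx
      rcases hx with rfl | rfl
      · exact hV 1 (by omega)
      · exact hV 2 (by omega)
    · simp [h01, h02]
    · intro X hX
      rw [union_empty]
      constructor
      · intro hPX
        by_contra hcon
        push Not at hcon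
        obtain ⟨c1, c2⟩ := hcon
        -- A set violating both alternatives lies in a singleton.
        have : ∃ i ≤ 2, X ⊆ {w i} := by
          by_cases h0 : w 0 ∈ X
          · refine ⟨0, by omega, fun x hx => ?_⟩
            have := c1 h0
            by_contra hx0
            have hx' := hX hx
            rw [mem_singleton] at hx0
            have : x ∈ X ∩ {w 1, w 2} := mem_inter.2 ⟨hx, (mem_insert.1 hx').resolve_left hx0⟩
            rw [c1 h0] at this
            exact notMem_empty _ this
          · by_cases h1 : w 1 ∈ X
            · refine ⟨1, by omega, fun x hx => ?_⟩
              have hx' := hX hx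
              simp only [mem_insert, mem_singleton] at hx' ⊢
              rcases hx' with rfl | rfl | rfl
              · exact absurd hx h0
              · rfl
              · exact absurd (insert_subset h1 (singleton_subset_iff.2 hx)) c2
            · refine ⟨2, by omega, fun x hx => ?_⟩
              have hx' := hX hx
              simp only [mem_insert, mem_singleton] at hx' ⊢
              rcases hx' with rfl | rfl | rfl
              · exact absurd hx h0
              · exact absurd hx h1
              · rfl
        obtain ⟨i, hi, hXi⟩ := this
        exact hs i (by omega) (h.mono _ _ hXi hPX)
      · rintro (⟨h0, x, hx⟩ | h12)
        · obtain ⟨hxX, hx⟩ := mem_inter.1 hx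
          rw [mem_insert, mem_singleton] at hx
          rcases hx with rfl | rfl
          · exact h.mono _ _ (insert_subset h0 (singleton_subset_iff.2 hxX)) e01
          · exact h.mono _ _ (insert_subset hxX (singleton_subset_iff.2 h0)) e20
        · exact h.mono _ _ h12 e12
  · have : NeZero (2 * k + 1) := ⟨by omega⟩
    have : Fact (1 < 2 * k + 1) := ⟨by omega⟩
    have hlt : ∀ i : ZMod (2 * k + 1), i.val < 2 * k + 1 := fun i => ZMod.val_lt i
    have hsucc : ∀ i : ZMod (2 * k + 1), (i.val < 2 * k ∧ (i + 1).val = i.val + 1) ∨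
        (i.val = 2 * k ∧ (i + 1).val = 0) := by
      intro i
      rcases lt_or_eq_of_le (Nat.le_of_lt_succ (hlt i)) with h1 | h1
      · refine Or.inl ⟨h1, ?_⟩
        rw [ZMod.val_add, ZMod.val_one, Nat.mod_eq_of_lt (by omega)]
      · refine Or.inr ⟨h1, ?_⟩
        rw [ZMod.val_add, ZMod.val_one, h1, Nat.mod_self]
    have hadj : ∀ i : ZMod (2 * k + 1), P {w i.val, w (i + 1).val} := by
      intro i
      rcases hsucc i with ⟨h1, h2⟩ | ⟨h1, h2⟩
      · rw [h2]
        exact hw _ (by omega)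
      · rw [h2, h1, ← hc]
        exact hw (2 * k) (by omega)
    refine h.hole ∅ (2 * k + 1) (fun i => w i.val) (empty_subset _) (by omega) ⟨k, rfl⟩ ?_
      (fun i => hV _ (hlt i).le) (fun i => notMem_empty _) ?_ ?_
    · intro i j hij
      apply ZMod.val_injective
      rcases lt_trichotomy i.val j.val with h1 | h1 | h1
      · exact absurd hij (hsplit _ _ h1 (hlt j))
      · exact h1
      · exact absurd hij.symm (hsplit _ _ h1 (hlt i))
    · intro i
      rw [union_empty]
      exact hs _ (hlt i).le
    · have key : ∀ i j : ZMod (2 * k + 1), i.val < j.val → P {w i.val, w j.val} →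
          j = i + 1 ∨ i = j + 1 := by
        intro i j hij hP
        by_contra hcon
        push Not at hcon
        refine hchord _ _ ?_ (hlt j) ?_ hP
        · by_contra hlt'
          apply hcon.1
          apply ZMod.val_injective
          have := hlt j
          rcases hsucc i with ⟨h1, h2⟩ | ⟨h1, h2⟩ <;> omega
        · rintro ⟨h0, h1⟩
          apply hcon.2
          apply ZMod.val_injective
          rcases hsucc j with ⟨h1, h2⟩ | ⟨h1, h2⟩ <;> omega
      intro i j hij
      rw [union_empty]
      constructor
      · intro hP
        rcases lt_trichotomy i.val j.val with h1 | h1 | h1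
        · exact key i j h1 hP
        · exact absurd (ZMod.val_injective _ h1) hij
        · rw [pair_comm] at hP
          exact (key j i h1 hP).symm
      · rintro (rfl | rfl)
        · exact hadj i
        · rw [pair_comm]
          exact hadj j

/-- If `F` is a minimal cover and `e ∉ F`, the sets `Y ⊆ F` such that `Y ∪ {e}` is a cover are
exactly those containing a fixed set `R`: otherwise, contracting a maximal `J ⊆ F` such that
`J ∪ {e}` is not a cover leaves a delta. -/
theorem exists_link (h : CleanOn P V) {F : Finset α} (hFV : F ⊆ V) (hF : P F)
    (hmin : ∀ f ∈ F, ¬ P (F.erase f)) {e : α} (heV : e ∈ V) (heF : e ∉ F) :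
    ∃ R ⊆ F, ∀ Y ⊆ F, P (insert e Y) ↔ R ⊆ Y := by
  classical
  refine ⟨F.filter (fun f => ¬ P (insert e (F.erase f))), filter_subset _ _, fun Y hY => ?_⟩
  constructor
  · intro hP f hf
    obtain ⟨hfF, hf⟩ := mem_filter.1 hf
    by_contra hfY
    exact hf (h.mono _ _ (insert_subset_insert _ (fun y hy =>
      mem_erase.2 ⟨fun hyf => hfY (hyf ▸ hy), hY hy⟩)) hP)
  · intro hRY
    by_contra hP
    obtain ⟨J, hJ, hJmax⟩ := exists_max_image
      (F.powerset.filter (fun J => Y ⊆ J ∧ ¬ P (insert e J))) card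
      ⟨Y, mem_filter.2 ⟨mem_powerset.2 hY, Subset.rfl, hP⟩⟩
    obtain ⟨hJF, hYJ, hPJ⟩ := mem_filter.1 hJ
    rw [mem_powerset] at hJF
    have hext : ∀ f ∈ F \ J, P (insert e (insert f J)) := by
      intro f hf
      obtain ⟨hfF, hfJ⟩ := mem_sdiff.1 hf
      by_contra hcon
      have := hJmax (insert f J) (mem_filter.2 ⟨mem_powerset.2 (insert_subset hfF hJF),
        hYJ.trans (subset_insert _ _), hcon⟩)
      rw [card_insert_of_notMem hfJ] at this
      omega
    have hFJ : J ≠ F := fun hEq => hPJ (h.mono _ _ (subset_insert _ _) (hEq ▸ hF))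
    have hne : (F \ J).Nonempty := sdiff_nonempty.2 (fun hs => hFJ (hJF.antisymm hs))
    have hcard : 2 ≤ (F \ J).card := by
      by_contra hlt
      have h1 : (F \ J).card = 1 := by
        have := hne.card_pos
        omega
      obtain ⟨f, hf⟩ := card_eq_one.1 h1
      have hfm : f ∈ F \ J := hf ▸ mem_singleton_self f
      have hJe : F.erase f ⊆ J := by
        intro x hx
        obtain ⟨hxf, hxF⟩ := mem_erase.1 hx
        by_contra hxJ
        have : x ∈ F \ J := mem_sdiff.2 ⟨hxF, hxJ⟩
        rw [hf, mem_singleton] at this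
        exact hxf this
      have : f ∈ Y := hRY (mem_filter.2 ⟨(mem_sdiff.1 hfm).1, fun hPf =>
        hPJ (h.mono _ _ (insert_subset_insert _ hJe) hPf)⟩)
      exact (mem_sdiff.1 hfm).2 (hYJ this)
    refine h.delta J (F \ J) e (hJF.trans hFV) (sdiff_subset.trans hFV) heV
      (fun hj => heF (hJF hj)) (fun hj => heF (mem_sdiff.1 hj).1) disjoint_sdiff hcard ?_
    intro X hX
    constructor
    · intro hPX
      by_cases heX : e ∈ X
      · refine Or.inl ⟨heX, ?_⟩
        by_contra hemp
        rw [not_nonempty_iff_eq_empty] at hemp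
        refine hPJ (h.mono _ _ (union_subset (fun x hx => ?_) (subset_insert _ _)) hPX)
        rcases mem_insert.1 (hX hx) with rfl | hx'
        · exact mem_insert_self _ _
        · have : x ∈ X ∩ (F \ J) := mem_inter.2 ⟨hx, hx'⟩
          rw [hemp] at this
          exact absurd this (notMem_empty _)
      · refine Or.inr (fun f hf => ?_)
        obtain ⟨hfF, hfJ⟩ := mem_sdiff.1 hf
        by_contra hfX
        refine hmin f hfF (h.mono _ _ (fun x hx => ?_) hPX)
        rcases mem_union.1 hx with hx | hx
        · rcases mem_insert.1 (hX hx) with rfl | hx'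
          · exact absurd hx heX
          · exact mem_erase.2 ⟨fun hxf => hfX (hxf ▸ hx), (mem_sdiff.1 hx').1⟩
        · exact mem_erase.2 ⟨fun hxf => hfJ (hxf ▸ hx), hJF hx⟩
    · rintro (⟨heX, f, hf⟩ | hFX)
      · obtain ⟨hfX, hf⟩ := mem_inter.1 hf
        exact h.mono _ _ (insert_subset (mem_union_left _ heX)
          (insert_subset (mem_union_left _ hfX) subset_union_right)) (hext f hf)
      · refine h.mono _ _ (fun f hf => ?_) hF
        by_cases hfJ : f ∈ J
        · exact mem_union_right _ hfJ
        · exact mem_union_left _ (hFX (mem_sdiff.2 ⟨hf, hfJ⟩))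

end CleanOn

end CoverPredicates

/-! ### Colour classes of a connected component are not covers -/

/-- `y` can be reached from `x` by a walk of length `n` along the relation `E`. -/
def WalkOfLength {α : Type*} (E : α → α → Prop) (n : ℕ) (x y : α) : Prop :=
  ∃ w : ℕ → α, w 0 = x ∧ w n = y ∧ ∀ i < n, E (w i) (w (i + 1))

namespace WalkOfLength

variable {α : Type*} {E : α → α → Prop}

theorem refl (x : α) : WalkOfLength E 0 x x := ⟨fun _ => x, rfl, rfl, by simp⟩

theorem single {x y : α} (h : E x y) : WalkOfLength E 1 x y := by
  refine ⟨fun i => if i = 0 then x else y, by simp, by simp, fun i hi => ?_⟩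
  obtain rfl : i = 0 := by omega
  simpa using h

theorem trans {m n : ℕ} {x y z : α} (h₁ : WalkOfLength E m x y) (h₂ : WalkOfLength E n y z) :
    WalkOfLength E (m + n) x z := by
  obtain ⟨u, hu0, hum, hu⟩ := h₁
  obtain ⟨v, hv0, hvn, hv⟩ := h₂
  refine ⟨fun i => if i < m then u i else v (i - m), ?_, ?_, fun i hi => ?_⟩
  · dsimp only
    split_ifs with h
    · exact hu0
    · obtain rfl : m = 0 := by omega
      rw [Nat.sub_zero, hv0, ← hum, hu0]
  · dsimp only
    rw [if_neg (by omega), Nat.add_sub_cancel_left, hvn]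
  · dsimp only
    rcases lt_trichotomy (i + 1) m with h | h | h
    · rw [if_pos (by omega), if_pos h]
      exact hu i (by omega)
    · rw [if_pos (by omega), if_neg (by omega), h, Nat.sub_self, hv0, ← hum, ← h]
      exact hu i (by omega)
    · rw [if_neg (by omega), if_neg (by omega), show i + 1 - m = i - m + 1 by omega]
      exact hv _ (by omega)

theorem symm (hE : ∀ x y, E x y → E y x) {n : ℕ} {x y : α} (h : WalkOfLength E n x y) :
    WalkOfLength E n y x := by
  obtain ⟨w, h0, hn, hw⟩ := h
  refine ⟨fun i => w (n - i), by simpa using hn, by simpa using h0, fun i hi => ?_⟩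
  dsimp only
  rw [show n - i = n - (i + 1) + 1 by omega]
  exact hE _ _ (hw _ (by omega))

theorem of_reflTransGen {x y : α} (h : Relation.ReflTransGen E x y) :
    ∃ n, WalkOfLength E n x y := by
  induction h with
  | refl => exact ⟨0, refl x⟩
  | tail _ hE ih =>
    obtain ⟨n, hn⟩ := ih
    exact ⟨n + 1, hn.trans (single hE)⟩

end WalkOfLength

section ColourClass

variable {α : Type*} [DecidableEq α] {P : Finset α → Prop} {V : Finset α}

/-- In a connected set `X` of two-element covers with proper `2`-colouring `c`, a colour class is not
a cover. Otherwise take a cover `F` of minimum cardinality inside the class and two of its elements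
`f, g` at minimum distance. Along a shortest walk from `f` to `g`, let `z` be the first vertex whose
link in `F` misses `f`. If `z` is at odd distance from `f`, contracting all but two elements of `F`
closes an odd walk; if at even distance, `z` can replace `f` in `F`, and `z`, `g` are closer. -/
theorem CleanOn.not_cover_colour_class (h : CleanOn P V) {E : α → α → Prop} {X : Finset α}
    (hXV : X ⊆ V) (hempty : ¬ P ∅) (hs : ∀ x ∈ X, ¬ P {x}) (hE : ∀ x y, E x y → P {x, y})
    (hX : ∀ x y, E x y → x ∈ X → y ∈ X) (c : α → Bool) (hc : ∀ x ∈ X, ∀ y, E x y → c x ≠ c y)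
    (hconn : ∀ x ∈ X, ∀ y ∈ X, ∃ n, WalkOfLength E n x y) (b : Bool) :
    ¬ P (X.filter (fun x => c x = b)) := by
  classical
  intro hPU
  set U := X.filter (fun x => c x = b) with hU
  obtain ⟨F₀, hF₀, hF₀min⟩ := exists_min_image (U.powerset.filter (fun F => P F)) card
    ⟨U, mem_filter.2 ⟨mem_powerset_self U, hPU⟩⟩
  obtain ⟨hF₀U, hPF₀⟩ := mem_filter.1 hF₀
  rw [mem_powerset] at hF₀U
  have hminc : ∀ F ⊆ U, P F → F₀.card ≤ F.card := fun F hF hP =>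
    hF₀min F (mem_filter.2 ⟨mem_powerset.2 hF, hP⟩)
  have hexists : ∃ n, ∃ F ⊆ U, P F ∧ F.card = F₀.card ∧ ∃ f ∈ F, ∃ g ∈ F, f ≠ g ∧
      WalkOfLength E n f g := by
    have hcard : 1 < F₀.card := by
      by_contra hlt
      obtain h0 | h1 : F₀.card = 0 ∨ F₀.card = 1 := by omega
      · exact hempty (card_eq_zero.1 h0 ▸ hPF₀)
      · obtain ⟨x, rfl⟩ := card_eq_one.1 h1
        exact hs x (mem_filter.1 (hF₀U (mem_singleton_self x))).1 hPF₀
    obtain ⟨f, hf, g, hg, hfg⟩ := one_lt_card.1 hcard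
    obtain ⟨n, hn⟩ := hconn f (mem_filter.1 (hF₀U hf)).1 g (mem_filter.1 (hF₀U hg)).1
    exact ⟨n, F₀, hF₀U, hPF₀, rfl, f, hf, g, hg, hfg, hn⟩
  obtain ⟨F, hFU, hPF, hFc, f, hf, g, hg, hfg, w, hw0, hwn, hw⟩ := Nat.find_spec hexists
  have hclosest : ∀ F ⊆ U, P F → F.card = F₀.card → ∀ f ∈ F, ∀ g ∈ F, f ≠ g → ∀ m,
      WalkOfLength E m f g → Nat.find hexists ≤ m := fun F hF hP hcd f hf g hg hne m hm =>
    Nat.find_min' hexists ⟨F, hF, hP, hcd, f, hf, g, hg, hne, hm⟩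
  generalize Nat.find hexists = n at *
  have hFX : F ⊆ X := hFU.trans (filter_subset _ _)
  have hFmin : ∀ f ∈ F, ¬ P (F.erase f) := by
    intro f hf hP
    have := hminc _ ((erase_subset _ _).trans hFU) hP
    rw [card_erase_of_mem hf, ← hFc] at this
    have := card_pos.2 ⟨f, hf⟩
    omega
  have hwX : ∀ i ≤ n, w i ∈ X := by
    intro i
    induction i with
    | zero => exact fun _ => hw0 ▸ hFX hf
    | succ i ih => exact fun hi => hX _ _ (hw i (by omega)) (ih (by omega))
  have hcol : ∀ i ≤ n, (c (w i) = b ↔ Even i) := by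
    intro i
    induction i with
    | zero =>
      intro _
      rw [hw0]
      simpa using (mem_filter.1 (hFU hf)).2
    | succ i ih =>
      intro hi
      have h1 := ih (by omega)
      have h2 := hc _ (hwX i (by omega)) _ (hw i (by omega))
      rw [Nat.even_add_one, ← h1]
      clear * - h2
      revert h2
      cases c (w i) <;> cases c (w (i + 1)) <;> cases b <;> simp
  have hn2 : 2 ≤ n := by
    have hneven : Even n := (hcol n le_rfl).1 (by rw [hwn]; exact (mem_filter.1 (hFU hg)).2)
    have : n ≠ 0 := by
      rintro rfl
      exact hfg (hw0.symm.trans hwn)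
    obtain ⟨k, rfl⟩ := hneven
    omega
  have hsub : ∀ i j, i ≤ j → j ≤ n → WalkOfLength E (j - i) (w i) (w j) := by
    intro i j hij hj
    refine ⟨fun t => w (i + t), rfl, by dsimp only; rw [Nat.add_sub_cancel' hij], fun t ht => ?_⟩
    exact hw (i + t) (by omega)
  have hint : ∀ i, 0 < i → i < n → w i ∉ F := by
    intro i hi0 hin hiF
    by_cases hif : w i = f
    · have := hclosest F hFU hPF hFc (w i) hiF g hg (hif ▸ hfg) _ (hwn ▸ hsub i n (by omega) le_rfl)
      omega
    · have := hclosest F hFU hPF hFc f hf (w i) hiF (Ne.symm hif) _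
        (hw0 ▸ hsub 0 i (by omega) (by omega))
      omega
  have hlink : ∀ e : α, ∃ R ⊆ F, e ∈ V → e ∉ F → ∀ Y ⊆ F, P (insert e Y) ↔ R ⊆ Y := by
    intro e
    by_cases he : e ∈ V ∧ e ∉ F
    · obtain ⟨R, hR, hRY⟩ := h.exists_link (hFX.trans hXV) hPF hFmin he.1 he.2
      exact ⟨R, hR, fun _ _ => hRY⟩
    · exact ⟨∅, empty_subset _, fun h1 h2 => absurd ⟨h1, h2⟩ he⟩
  choose R hRF hR' using hlink
  have hR : ∀ i, 0 < i → i < n → ∀ Y ⊆ F, P (insert (w i) Y) ↔ R (w i) ⊆ Y := fun i h0 hin =>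
    hR' (w i) (hXV (hwX i hin.le)) (hint i h0 hin)
  have hRne : ∀ i, 0 < i → i < n → (R (w i)).Nonempty := by
    intro i h0 hin
    by_contra hemp
    rw [not_nonempty_iff_eq_empty] at hemp
    have := (hR i h0 hin ∅ (empty_subset _)).2 (by rw [hemp])
    exact hs (w i) (hwX i hin.le) (by simpa using this)
  have hRsub1 : R (w 1) ⊆ {f} := by
    refine (hR 1 (by omega) (by omega) {f} (singleton_subset_iff.2 hf)).1 ?_
    have := hE _ _ (hw 0 (by omega))
    rwa [hw0, pair_comm] at this
  have hRsubn : R (w (n - 1)) ⊆ {g} := by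
    refine (hR (n - 1) (by omega) (by omega) {g} (singleton_subset_iff.2 hg)).1 ?_
    have := hE _ _ (hw (n - 1) (by omega))
    rwa [show n - 1 + 1 = n by omega, hwn] at this
  have hmiss : ∃ i, 0 < i ∧ i < n ∧ f ∉ R (w i) :=
    ⟨n - 1, by omega, by omega, fun hfR => hfg (mem_singleton.1 (hRsubn hfR))⟩
  obtain ⟨hi0, hin, hfi⟩ := Nat.find_spec hmiss
  have hifirst : ∀ j, 0 < j → j < Nat.find hmiss → f ∈ R (w j) := by
    intro j hj0 hj
    by_contra hcon
    exact Nat.find_min hmiss hj ⟨hj0, by omega, hcon⟩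
  generalize Nat.find hmiss = i at *
  rcases Nat.even_or_odd i with hev | hodd
  -- `w i` has the colour of `f` and its link misses `f`, so it can replace `f` in `F`.
  · have hiF := hint i hi0 hin
    have hgi : g ≠ w i := fun he => hiF (he ▸ hg)
    have := hclosest (insert (w i) (F.erase f)) ?_ ?_ ?_ (w i) (mem_insert_self _ _) g
      (mem_insert_of_mem (mem_erase.2 ⟨hfg.symm, hg⟩)) hgi.symm _ (hwn ▸ hsub i n (by omega) le_rfl)
    · omega
    · refine insert_subset (mem_filter.2 ⟨hwX i hin.le, (hcol i hin.le).2 hev⟩)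
        ((erase_subset _ _).trans hFU)
    · refine (hR i hi0 hin _ (erase_subset _ _)).2 (fun x hx => mem_erase.2 ⟨?_, hRF _ hx⟩)
      rintro rfl
      exact hfi hx
    · rw [card_insert_of_notMem (fun hx => hiF (mem_of_mem_erase hx)), card_erase_of_mem hf, ← hFc]
      have := card_pos.2 ⟨f, hf⟩
      omega
  -- After contracting `J`, the element `w i` is joined to some `g'` in its link and `g'` is joined
  -- to `f`, which closes the walk `f, w 1, …, w i, g', f` of odd length `i + 2`.
  · obtain ⟨g', hg'⟩ := hRne i hi0 hin
    have hg'F := hRF _ hg'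
    have hfg' : f ≠ g' := fun he => hfi (he ▸ hg')
    set J := F \ {f, g'} with hJ
    have hJF : J ⊆ F := sdiff_subset
    have hfJ : f ∉ J := by simp [hJ]
    have hgJ : g' ∉ J := by simp [hJ]
    have hnR : ∀ j, 0 < j → j ≤ i → ¬ P ({w j} ∪ J) := by
      intro j hj0 hji hP
      rw [← insert_eq] at hP
      have hsubJ := (hR j hj0 (by omega) J hJF).1 hP
      rcases hji.lt_or_eq with hlt | rfl
      · exact hfJ (hsubJ (hifirst j hj0 hlt))
      · exact hgJ (hsubJ hg')
    have hnF : ∀ x ∈ F, ∀ y ∈ F, x ≠ y → y ∉ J → ¬ P ({x} ∪ J) := by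
      intro x hx y hy hxy hyJ hP
      refine hFmin y hy (h.mono _ _ (union_subset (singleton_subset_iff.2 (mem_erase.2 ⟨hxy, hx⟩))
        (fun z hz => mem_erase.2 ⟨fun hzy => hyJ (hzy ▸ hz), hJF hz⟩)) hP)
    refine (h.shift (hJF.trans (hFX.trans hXV))).no_odd_closed_walk (i + 2) (by grind)
      (fun t => if t ≤ i then w t else if t = i + 1 then g' else f) ?_ ?_ ?_ ?_
    · intro t ht
      refine mem_sdiff.2 ?_
      split_ifs with h1 h2
      · refine ⟨hXV (hwX t (by omega)), ?_⟩
        rcases Nat.eq_zero_or_pos t with rfl | hpos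
        · rwa [hw0]
        · exact fun hx => hint t hpos (by omega) (hJF hx)
      · exact ⟨hXV (hFX hg'F), hgJ⟩
      · exact ⟨hXV (hFX hf), hfJ⟩
    · intro t ht
      split_ifs with h1 h2
      · rcases Nat.eq_zero_or_pos t with rfl | hpos
        · rw [hw0]
          exact hnF f hf g' hg'F hfg' hgJ
        · exact hnR t hpos h1
      · exact hnF g' hg'F f hf hfg'.symm hfJ
      · exact hnF f hf g' hg'F hfg' hgJ
    · rw [if_neg (by omega), if_neg (by omega), if_pos (by omega), hw0]
    · intro t ht
      obtain h1 | rfl | rfl : t < i ∨ t = i ∨ t = i + 1 := by omega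
      · rw [if_pos (by omega), if_pos (by omega)]
        exact h.mono _ _ subset_union_left (hE _ _ (hw t (by omega)))
      · rw [if_pos (by omega), if_neg (by omega), if_pos (by omega)]
        have : P (insert (w t) (insert g' J)) := by
          refine (hR t hi0 hin _ (insert_subset hg'F hJF)).2 (fun x hx => ?_)
          by_cases hxg : x = g'
          · rw [hxg]
            exact mem_insert_self _ _
          · refine mem_insert_of_mem (mem_sdiff.2 ⟨hRF _ hx, ?_⟩)
            simp only [mem_insert, mem_singleton, not_or]
            exact ⟨fun hxf => hfi (hxf ▸ hx), hxg⟩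
        refine h.mono _ _ (fun x hx => ?_) this
        simpa [or_assoc] using hx
      · rw [if_neg (by omega), if_pos (by omega), if_neg (by omega), if_neg (by omega)]
        refine h.mono _ _ (fun x hx => ?_) hPF
        by_cases hxJ : x ∈ J
        · exact mem_union_right _ hxJ
        · refine mem_union_left _ ?_
          rw [hJ, mem_sdiff] at hxJ
          push Not at hxJ
          rw [pair_comm]
          exact hxJ hx

end ColourClass

/-! ### Covers, minors and blockers -/

namespace Clutter

section Hits

variable {α : Type*} [DecidableEq α]

/-- `X` meets every member of `C`. Unlike for `IsCover`, `X` need not lie in the ground set. -/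
def Hits (C : Clutter α) (X : Finset α) : Prop :=
  ∀ A ∈ C.members, (A ∩ X).Nonempty

theorem Hits.mono {C : Clutter α} {X Y : Finset α} (h : C.Hits X) (hXY : X ⊆ Y) : C.Hits Y :=
  fun A hA => (h A hA).mono (inter_subset_inter_left hXY)

theorem exists_mem_minimalSets {F : Finset (Finset α)} {A : Finset α} (hA : A ∈ F) :
    ∃ B ∈ minimalSets F, B ⊆ A := by
  obtain ⟨B, hB, hBmin⟩ := exists_min_image (F.filter (fun B => B ⊆ A)) card
    ⟨A, mem_filter.2 ⟨hA, Subset.rfl⟩⟩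
  obtain ⟨hBF, hBA⟩ := mem_filter.1 hB
  refine ⟨B, mem_filter.2 ⟨hBF, fun D hD hDB => ?_⟩, hBA⟩
  exact eq_of_subset_of_card_le hDB (hBmin D (mem_filter.2 ⟨hD, hDB.trans hBA⟩))

theorem hits_minor_iff (C : Clutter α) {I J X : Finset α} (hX : Disjoint X J) :
    (C.minor I J).Hits X ↔ C.Hits (X ∪ I) := by
  constructor
  · intro h A hA
    by_cases hAI : A ∩ I = ∅
    · obtain ⟨B, hB, hBA⟩ := exists_mem_minimalSets
        (mem_image_of_mem (fun A => A \ J)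
          (mem_filter (p := fun A => A ∩ I = ∅) |>.2 ⟨hA, hAI⟩))
      obtain ⟨x, hx⟩ := h B hB
      rw [mem_inter] at hx
      exact ⟨x, mem_inter.2 ⟨(mem_sdiff.1 (hBA hx.1)).1, mem_union_left _ hx.2⟩⟩
    · exact (nonempty_iff_ne_empty.2 hAI).mono (inter_subset_inter_left subset_union_right)
  · intro h B hB
    obtain ⟨A, hA, rfl⟩ := mem_image.1 (mem_filter.1 hB).1
    obtain ⟨hA, hAI⟩ := mem_filter.1 hA
    obtain ⟨x, hx⟩ := h A hA
    obtain ⟨hxA, hx⟩ := mem_inter.1 hx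
    have hxX : x ∈ X := (mem_union.1 hx).resolve_right (fun hxI => by
      have : x ∈ A ∩ I := mem_inter.2 ⟨hxA, hxI⟩
      rw [hAI] at this
      exact notMem_empty _ this)
    exact ⟨x, mem_inter.2 ⟨mem_sdiff.2 ⟨hxA, disjoint_left.1 hX hxX⟩, hxX⟩⟩

theorem hits_sdiff_iff (C : Clutter α) (A : Finset α) :
    C.Hits (C.ground \ A) ↔ ∀ B ∈ C.members, ¬ B ⊆ A := by
  refine forall₂_congr (fun B hB => ?_)
  constructor
  · rintro ⟨x, hx⟩ hBA
    simp only [mem_inter, mem_sdiff] at hx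
    exact hx.2.2 (hBA hx.1)
  · intro h
    obtain ⟨x, hxB, hxA⟩ := not_subset.1 h
    exact ⟨x, mem_inter.2 ⟨hxB, mem_sdiff.2 ⟨C.subset_ground B hB hxB, hxA⟩⟩⟩

/-- A clutter is determined by its ground set and its covers. -/
theorem ext_of_hits {C D : Clutter α} (hg : C.ground = D.ground)
    (h : ∀ X ⊆ C.ground, C.Hits X ↔ D.Hits X) : C = D := by
  have key : ∀ {C D : Clutter α}, C.ground = D.ground → (∀ X ⊆ C.ground, C.Hits X ↔ D.Hits X) →
      ∀ A ∈ C.members, ∃ B ∈ D.members, B ⊆ A := by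
    intro C D hg h A hA
    by_contra hcon
    push Not at hcon
    have h1 := (D.hits_sdiff_iff A).2 hcon
    rw [← hg] at h1
    exact (C.hits_sdiff_iff A).1 ((h _ sdiff_subset).2 h1) A hA Subset.rfl
  have key2 : ∀ {C D : Clutter α}, C.ground = D.ground → (∀ X ⊆ C.ground, C.Hits X ↔ D.Hits X) →
      C.members ⊆ D.members := by
    intro C D hg h A hA
    obtain ⟨B, hB, hBA⟩ := key hg h A hA
    obtain ⟨A', hA', hA'B⟩ := key hg.symm (fun X hX => (h X (hg ▸ hX)).symm) B hB
    have := C.antichain A' hA' A hA (hA'B.trans hBA)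
    subst this
    rwa [hA'B.antisymm hBA]
  have hm : C.members = D.members :=
    (key2 hg h).antisymm (key2 hg.symm (fun X hX => (h X (hg ▸ hX)).symm))
  cases C
  cases D
  simp only at hg hm
  subst hg hm
  rfl

theorem minor_minor (C : Clutter α) {I J I' J' : Finset α} (h : Disjoint I' J) :
    (C.minor I J).minor I' J' = C.minor (I ∪ I') (J ∪ J') := by
  have hg : ((C.minor I J).minor I' J').ground = (C.minor (I ∪ I') (J ∪ J')).ground := by
    ext x
    simp only [minor, mem_sdiff, mem_union]
    tauto
  refine ext_of_hits hg (fun X hX => ?_)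
  have hX' : ∀ x ∈ X, (x ∉ I ∧ x ∉ J) ∧ x ∉ I' ∧ x ∉ J' := by
    intro x hx
    have := hX hx
    simp only [minor, mem_sdiff, mem_union] at this
    tauto
  rw [hits_minor_iff, hits_minor_iff, hits_minor_iff]
  · rw [union_assoc, union_comm I' I]
  · rw [disjoint_left]
    intro x hx
    have := hX' x hx
    rw [mem_union]
    tauto
  · rw [disjoint_union_left]
    exact ⟨disjoint_left.2 (fun x hx => (hX' x hx).1.2), h⟩
  · exact disjoint_left.2 (fun x hx => (hX' x hx).2.2)

theorem IsClean.minor {C : Clutter α} (h : C.IsClean) {I J : Finset α} (hI : I ⊆ C.ground)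
    (hJ : J ⊆ C.ground) (hIJ : Disjoint I J) : (C.minor I J).IsClean := by
  intro I' J' hI' hJ' hIJ'
  have hI'' : ∀ x ∈ I', x ∈ C.ground ∧ x ∉ I ∧ x ∉ J := by
    intro x hx
    simpa [Clutter.minor] using hI' hx
  have hJ'' : ∀ x ∈ J', x ∈ C.ground ∧ x ∉ I ∧ x ∉ J := by
    intro x hx
    simpa [Clutter.minor] using hJ' hx
  rw [minor_minor C (disjoint_left.2 (fun x hx => (hI'' x hx).2.2))]
  refine h _ _ (union_subset hI (fun x hx => (hI'' x hx).1))
    (union_subset hJ (fun x hx => (hJ'' x hx).1)) ?_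
  rw [disjoint_union_left, disjoint_union_right, disjoint_union_right]
  exact ⟨⟨hIJ, disjoint_right.2 (fun x hx => (hJ'' x hx).2.1)⟩,
    disjoint_left.2 (fun x hx => (hI'' x hx).2.2), hIJ'⟩

theorem hits_blocker_iff (C : Clutter α) {X : Finset α} :
    C.blocker.Hits X ↔ ¬ C.Hits (C.ground \ X) := by
  constructor
  · intro h hC
    obtain ⟨B, hB, hBX⟩ := exists_mem_minimalSets (F := C.ground.powerset.filter C.IsCover)
      (A := C.ground \ X) (mem_filter.2 ⟨mem_powerset.2 sdiff_subset, sdiff_subset, hC⟩)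
    obtain ⟨x, hx⟩ := h B hB
    obtain ⟨hxB, hxX⟩ := mem_inter.1 hx
    exact (mem_sdiff.1 (hBX hxB)).2 hxX
  · intro h B hB
    by_contra hcon
    obtain ⟨hBg, hBc⟩ := mem_filter.1 (mem_filter.1 hB).1
    refine h (Hits.mono hBc.2 (fun x hx => mem_sdiff.2 ⟨hBc.1 hx, fun hxX => hcon ?_⟩))
    exact ⟨x, mem_inter.2 ⟨hx, hxX⟩⟩

theorem blocker_blocker (C : Clutter α) : C.blocker.blocker = C := by
  refine ext_of_hits rfl (fun X hX => ?_)
  have hX' : X ⊆ C.ground := hX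
  rw [hits_blocker_iff, hits_blocker_iff, not_not]
  change C.Hits (C.ground \ (C.ground \ X)) ↔ _
  rw [Finset.sdiff_sdiff_eq_self hX']

theorem IsDelta.of_hits {D : Clutter α} {Y : Finset α} {a : α} (hg : D.ground = insert a Y)
    (haY : a ∉ Y) (hY : 2 ≤ Y.card)
    (h : ∀ X ⊆ insert a Y, D.Hits X ↔ ((a ∈ X ∧ (X ∩ Y).Nonempty) ∨ Y ⊆ X)) : D.IsDelta := by
  have hYne : Y.Nonempty := card_pos.1 (by omega)
  have hpair : ∀ y ∈ Y, ¬ Y ⊆ {a, y} := by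
    intro y hy hsub
    have : Y ⊆ {y} := by
      intro z hz
      have := hsub hz
      simp only [mem_insert, mem_singleton] at this ⊢
      exact this.resolve_left (fun hza => haY (hza ▸ hz))
    have := card_le_card this
    rw [card_singleton] at this
    omega
  let E : Clutter α :=
    { ground := insert a Y
      members := insert Y (Y.image (fun b => {a, b}))
      subset_ground := by
        intro A hA
        rcases mem_insert.1 hA with rfl | hA
        · exact subset_insert _ _
        · obtain ⟨y, hy, rfl⟩ := mem_image.1 hA
          exact insert_subset_insert _ (singleton_subset_iff.2 hy)
      antichain := by
        intro A hA B hB hAB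
        rcases mem_insert.1 hA with rfl | hA <;> rcases mem_insert.1 hB with rfl | hB
        · rfl
        · obtain ⟨y, hy, rfl⟩ := mem_image.1 hB
          exact absurd hAB (hpair y hy)
        · obtain ⟨y, hy, rfl⟩ := mem_image.1 hA
          exact absurd (hAB (mem_insert_self _ _)) haY
        · obtain ⟨y, hy, rfl⟩ := mem_image.1 hA
          obtain ⟨z, hz, rfl⟩ := mem_image.1 hB
          have : y ∈ ({a, z} : Finset α) := hAB (by simp)
          simp only [mem_insert, mem_singleton] at this
          rcases this with rfl | rfl
          · exact absurd hy haY
          · rfl }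
  have hDE : D = E := by
    refine ext_of_hits hg (fun X hX => ?_)
    rw [h X (hg ▸ hX)]
    constructor
    · rintro (⟨haX, x, hx⟩ | hYX) A hA
      · rcases mem_insert.1 hA with rfl | hA
        · rw [inter_comm]
          exact ⟨x, hx⟩
        · obtain ⟨y, hy, rfl⟩ := mem_image.1 hA
          exact ⟨a, mem_inter.2 ⟨mem_insert_self _ _, haX⟩⟩
      · rcases mem_insert.1 hA with rfl | hA
        · rwa [inter_eq_left.2 hYX]
        · obtain ⟨y, hy, rfl⟩ := mem_image.1 hA
          exact ⟨y, mem_inter.2 ⟨by simp, hYX hy⟩⟩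
    · intro hE
      by_cases haX : a ∈ X
      · left
        refine ⟨haX, ?_⟩
        rw [inter_comm]
        exact hE Y (mem_insert_self _ _)
      · right
        intro y hy
        obtain ⟨x, hx⟩ := hE {a, y} (mem_insert_of_mem (mem_image_of_mem _ hy))
        simp only [mem_inter, mem_insert, mem_singleton] at hx
        rcases hx with ⟨rfl | rfl, hxX⟩
        · exact absurd hxX haX
        · exact hxX
  rw [hDE]
  refine ⟨?_, a, mem_insert_self _ _, ?_⟩
  · change 3 ≤ (insert a Y).card
    rw [card_insert_of_notMem haY]
    omega
  · change insert Y _ = insert ((insert a Y).erase a) (((insert a Y).erase a).image _)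
    rw [erase_insert haY]

theorem isExtendedOddHole_blocker {D : Clutter α} {n : ℕ} (hn : 5 ≤ n) (ho : Odd n)
    (a : ZMod n → α) (hinj : Function.Injective a) (hg : Set.range a = (D.ground : Set α))
    (hs : ∀ i, ¬ D.Hits {a i})
    (hp : ∀ i j, i ≠ j → (D.Hits {a i, a j} ↔ (j = i + 1 ∨ i = j + 1))) :
    D.blocker.IsExtendedOddHole := by
  refine ⟨n, hn, ho, a, hinj, hg, ?_⟩
  have : Fact (1 < n) := ⟨by omega⟩
  have hsucc : ∀ i : ZMod n, i ≠ i + 1 := by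
    intro i h
    exact one_ne_zero (α := ZMod n) (left_eq_add.1 h)
  have hmem : ∀ i, a i ∈ D.ground := by
    intro i
    rw [← mem_coe, ← hg]
    exact Set.mem_range_self i
  have hsurj : ∀ x ∈ D.ground, ∃ i, a i = x := by
    intro x hx
    rw [← mem_coe, ← hg] at hx
    exact hx
  -- A cover has at least two elements.
  have htwo : ∀ B, D.IsCover B → 2 ≤ B.card := by
    intro B hB
    by_contra hlt
    have : ∃ i, B ⊆ {a i} := by
      obtain h0 | h1 : B.card = 0 ∨ B.card = 1 := by omega
      · exact ⟨0, by rw [card_eq_zero.1 h0]; exact empty_subset _⟩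
      · obtain ⟨x, rfl⟩ := card_eq_one.1 h1
        obtain ⟨i, rfl⟩ := hsurj x (hB.1 (mem_singleton_self x))
        exact ⟨i, Subset.rfl⟩
    obtain ⟨i, hi⟩ := this
    exact hs i (Hits.mono hB.2 hi)
  have hmc : ∀ B ∈ D.blocker.members, D.IsCover B := fun B hB =>
    (mem_filter.1 (mem_filter.1 hB).1).2
  have hpm : ∀ i, ({a i, a (i + 1)} : Finset α) ∈ D.blocker.members := by
    intro i
    have hcov : D.IsCover {a i, a (i + 1)} :=
      ⟨insert_subset (hmem _) (singleton_subset_iff.2 (hmem _)),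
        (hp i (i + 1) (hsucc i)).2 (Or.inl rfl)⟩
    refine mem_filter.2 ⟨mem_filter.2 ⟨mem_powerset.2 hcov.1, hcov⟩, fun B hB hBsub => ?_⟩
    refine eq_of_subset_of_card_le hBsub ?_
    rw [card_pair (fun h => hsucc i (hinj h))]
    exact htwo B (mem_filter.1 hB).2
  intro A
  constructor
  · rintro ⟨hA, hAmin⟩
    have h1 := hAmin _ (hpm 0)
    rw [card_pair (fun h => hsucc 0 (hinj h))] at h1
    have hAc := hmc A hA
    obtain ⟨x, y, hxy, rfl⟩ := card_eq_two.1 (le_antisymm h1 (htwo A hAc))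
    obtain ⟨i, rfl⟩ := hsurj x (hAc.1 (by simp))
    obtain ⟨j, rfl⟩ := hsurj y (hAc.1 (by simp))
    rcases (hp i j (fun h => hxy (h ▸ rfl))).1 hAc.2 with rfl | rfl
    · exact ⟨i, rfl⟩
    · exact ⟨j, pair_comm _ _⟩
  · rintro ⟨i, rfl⟩
    refine ⟨hpm i, fun B hB => ?_⟩
    rw [card_pair (fun h => hsucc i (hinj h))]
    exact htwo B (hmc B hB)

theorem IsClean.cleanOn {C : Clutter α} (h : C.IsClean) : CleanOn C.Hits C.ground where
  mono X Y hXY hX := Hits.mono hX hXY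
  delta I Y a hI hY haV haI haY hIY hc hall := by
    set W := insert a Y with hW
    have hWg : W ⊆ C.ground := insert_subset haV hY
    have hWI : Disjoint W I := by
      rw [hW, disjoint_insert_left]
      exact ⟨haI, hIY.symm⟩
    refine (h I (C.ground \ (I ∪ W)) hI sdiff_subset ?_).1
      (IsDelta.of_hits (Y := Y) (a := a) ?_ haY hc ?_)
    · exact disjoint_of_subset_left subset_union_left disjoint_sdiff
    · ext x
      have h1 : x ∈ W → x ∈ C.ground := fun hx => hWg hx
      have h2 : x ∈ W → x ∉ I := fun hx => disjoint_left.1 hWI hx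
      rw [← hW]
      simp only [Clutter.minor, mem_sdiff, mem_union]
      tauto
    · intro X hX
      rw [hits_minor_iff]
      · exact hall X hX
      · exact disjoint_of_subset_left (hX.trans subset_union_right) disjoint_sdiff
  hole I n a hI hn ho hinj haV haI hs hp := by
    have : NeZero n := ⟨by omega⟩
    set W := univ.image a with hW
    have hWg : W ⊆ C.ground := by
      intro x hx
      obtain ⟨i, -, rfl⟩ := mem_image.1 hx
      exact haV i
    have hWI : Disjoint W I := by
      rw [disjoint_left]
      intro x hx
      obtain ⟨i, -, rfl⟩ := mem_image.1 hx
      exact haI i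
    have hdis : ∀ X ⊆ W, Disjoint X (C.ground \ (I ∪ W)) := fun X hX =>
      disjoint_of_subset_left (hX.trans subset_union_right) disjoint_sdiff
    have haW : ∀ i, a i ∈ W := fun i => mem_image_of_mem _ (mem_univ i)
    refine (h I (C.ground \ (I ∪ W)) hI sdiff_subset ?_).2
      ⟨_, isExtendedOddHole_blocker hn ho a hinj ?_ ?_ ?_, (blocker_blocker _).symm⟩
    · exact disjoint_of_subset_left subset_union_left disjoint_sdiff
    · have : (C.minor I (C.ground \ (I ∪ W))).ground = W := by
        ext x
        have h1 : x ∈ W → x ∈ C.ground := fun hx => hWg hx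
        have h2 : x ∈ W → x ∉ I := fun hx => disjoint_left.1 hWI hx
        simp only [Clutter.minor, mem_sdiff, mem_union]
        tauto
      rw [this, hW]
      simp
    · intro i
      rw [hits_minor_iff _ (hdis _ (singleton_subset_iff.2 (haW i)))]
      exact hs i
    · intro i j hij
      rw [hits_minor_iff _ (hdis _ (insert_subset (haW i) (singleton_subset_iff.2 (haW j))))]
      exact hp i j hij

end Hits

end Clutter

/-! ### Splitting off a connected component -/

namespace Clutter

section Split

variable {α : Type*} [DecidableEq α]

/-- A weakening of `IsTangled` suited to induction: every element lies in a two-element cover and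
there is no smaller cover. Besides the tangled clutters, it allows the clutter with empty ground set
and the single member `∅`. -/
structure IsPretangled (C : Clutter α) : Prop where
  exists_pair : ∀ v ∈ C.ground, ∃ u, C.IsCover {v, u}
  two_le_card : ∀ B, C.IsCover B → 2 ≤ B.card

/-- Two elements are connected if they are joined by a walk of two-element covers. -/
def Conn (C : Clutter α) : α → α → Prop :=
  Relation.ReflTransGen (fun u v => C.IsCover {u, v})

theorem isCover_pair_symm {C : Clutter α} {u v : α} (h : C.IsCover {u, v}) : C.IsCover {v, u} := by
  rwa [pair_comm]

theorem Conn.symm {C : Clutter α} {u v : α} (h : C.Conn u v) : C.Conn v u :=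
  by
  induction h with
  | refl => exact Relation.ReflTransGen.refl
  | tail _ hE ih => exact Relation.ReflTransGen.head (isCover_pair_symm hE) ih

/-- The two colour classes `U`, `U'` of a connected component, together with what the induction
uses: a member missing one class contains the other one, and the two minors that delete one class
and contract the other one are clean and pretangled again. -/
structure IsSplit (C : Clutter α) (U U' : Finset α) : Prop where
  left_subset : U ⊆ C.ground
  right_subset : U' ⊆ C.ground
  disj : Disjoint U U'
  left_of_right : ∀ A ∈ C.members, A ∩ U' = ∅ → U ⊆ A
  right_of_left : ∀ A ∈ C.members, A ∩ U = ∅ → U' ⊆ A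
  clean_left : (C.minor U' U).IsClean
  clean_right : (C.minor U U').IsClean
  pre_left : (C.minor U' U).IsPretangled
  pre_right : (C.minor U U').IsPretangled

theorem IsSplit.symm {C : Clutter α} {U U' : Finset α} (h : C.IsSplit U U') : C.IsSplit U' U :=
  ⟨h.right_subset, h.left_subset, h.disj.symm, h.right_of_left, h.left_of_right, h.clean_right,
    h.clean_left, h.pre_right, h.pre_left⟩

theorem exists_isSplit {C : Clutter α} (hC : C.IsClean) (hP : C.IsPretangled) {v : α}
    (hv : v ∈ C.ground) : ∃ U U', C.IsSplit U U' ∧ v ∈ U ∧ U'.Nonempty ∧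
      ∀ u ∈ C.ground, u ∈ U ∪ U' ↔ C.Conn v u := by
  classical
  set E : α → α → Prop := fun u v => C.IsCover {u, v} with hE
  have hEsymm : ∀ x y, E x y → E y x := fun _ _ => isCover_pair_symm
  have hEg : ∀ x y, E x y → x ∈ C.ground ∧ y ∈ C.ground := fun x y h =>
    ⟨h.1 (by simp), h.1 (by simp)⟩
  set c : α → Bool := fun x => decide (∃ n, Even n ∧ WalkOfLength E n v x) with hcdef
  have hct : ∀ x, c x = true ↔ ∃ n, Even n ∧ WalkOfLength E n v x := fun x => by simp [hcdef]
  set X := C.ground.filter (fun x => C.Conn v x) with hX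
  have hXE : ∀ x y, E x y → x ∈ X → y ∈ X := fun x y hxy hx =>
    mem_filter.2 ⟨(hEg _ _ hxy).2, (mem_filter.1 hx).2.tail hxy⟩
  have hs : ∀ x ∈ C.ground, ¬ C.Hits {x} := by
    intro x hx hh
    have := hP.two_le_card {x} ⟨singleton_subset_iff.2 hx, hh⟩
    rw [card_singleton] at this
    omega
  have hconn : ∀ x ∈ X, ∃ n, WalkOfLength E n v x := fun x hx =>
    WalkOfLength.of_reflTransGen (mem_filter.1 hx).2
  have hc : ∀ x ∈ X, ∀ y, E x y → c x ≠ c y := by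
    intro x hx y hxy heq
    cases hcx : c x with
    | true =>
      obtain ⟨n, hn, hwn⟩ := (hct x).1 hcx
      obtain ⟨m, hm, hwm⟩ := (hct y).1 (heq ▸ hcx)
      obtain ⟨w, hw0, hwl, hw⟩ := (hwn.trans (.single hxy)).trans (hwm.symm hEsymm)
      have hmem : ∀ i ≤ n + 1 + m, w i ∈ C.ground := by
        intro i hi
        rcases hi.lt_or_eq with hlt | rfl
        · exact (hEg _ _ (hw i hlt)).1
        · rw [hwl, ← hw0]
          exact (hEg _ _ (hw 0 (by omega))).1
      exact hC.cleanOn.no_odd_closed_walk (n + 1 + m) (hn.add_one.add_even hm) w hmem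
        (fun i hi => hs _ (hmem i hi)) (hwl.trans hw0.symm) (fun i hi => (hw i hi).2)
    | false =>
      obtain ⟨n, hn⟩ := hconn x hx
      have hodd : ¬ Even n := by
        intro he
        rw [(hct x).2 ⟨n, he, hn⟩] at hcx
        exact absurd hcx (by simp)
      have hy : c y = true := (hct y).2 ⟨n + 1, Nat.even_add_one.2 hodd, hn.trans (.single hxy)⟩
      rw [heq, hy] at hcx
      exact absurd hcx (by simp)
  have hXg : X ⊆ C.ground := filter_subset _ _
  have hvX : v ∈ X := mem_filter.2 ⟨hv, Relation.ReflTransGen.refl⟩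
  set K : Bool → Finset α := fun b => X.filter (fun x => c x = b) with hK
  have hKX : ∀ b, K b ⊆ X := fun b => filter_subset _ _
  have hKdis : ∀ b, Disjoint (K b) (K !b) := by
    intro b
    rw [disjoint_left]
    intro x hx hx'
    have h1 := (mem_filter.1 hx).2
    rw [(mem_filter.1 hx').2] at h1
    cases b <;> simp at h1
  have hKunion : ∀ b, ∀ x, x ∈ K b ∨ x ∈ K (!b) ↔ x ∈ X := by
    intro b x
    refine ⟨fun h => h.elim (fun h => hKX _ h) (fun h => hKX _ h), fun hx => ?_⟩
    simp only [hK, mem_filter, hx, true_and]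
    cases c x <;> cases b <;> simp
  have hforced : ∀ b, ∀ A ∈ C.members, A ∩ K (!b) = ∅ → K b ⊆ A := by
    intro b A hA hAK u hu
    obtain ⟨y, huy⟩ := hP.exists_pair u (hXg (hKX _ hu))
    have hyK : y ∈ K !b := by
      refine mem_filter.2 ⟨hXE u y huy (hKX _ hu), ?_⟩
      have h1 := hc u (hKX _ hu) y huy
      rw [(mem_filter.1 hu).2] at h1
      exact Bool.eq_not.2 h1.symm
    obtain ⟨z, hz⟩ := huy.2 A hA
    simp only [mem_inter, mem_insert, mem_singleton] at hz
    rcases hz with ⟨hzA, rfl | rfl⟩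
    · exact hzA
    · have : z ∈ A ∩ K !b := mem_inter.2 ⟨hzA, hyK⟩
      rw [hAK] at this
      exact absurd this (notMem_empty _)
  have hclean : ∀ b, (C.minor (K !b) (K b)).IsClean := fun b =>
    hC.minor ((hKX _).trans hXg) ((hKX _).trans hXg) (hKdis b).symm
  have hpre : ∀ b, (C.minor (K !b) (K b)).IsPretangled := by
    intro b
    have hgr : ∀ x, x ∈ (C.minor (K !b) (K b)).ground ↔ x ∈ C.ground ∧ x ∉ X := by
      intro x
      rw [← hKunion b x]
      simp only [Clutter.minor, mem_sdiff, mem_union]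
      tauto
    constructor
    · intro x hx
      obtain ⟨hxg, hxX⟩ := (hgr x).1 hx
      obtain ⟨y, hxy⟩ := hP.exists_pair x hxg
      have hyX : y ∉ X := fun hy => hxX (hXE y x (hEsymm _ _ hxy) hy)
      refine ⟨y, insert_subset hx (singleton_subset_iff.2 ((hgr y).2 ⟨(hEg _ _ hxy).2, hyX⟩)), ?_⟩
      change (C.minor (K !b) (K b)).Hits _
      rw [hits_minor_iff]
      · exact Hits.mono hxy.2 subset_union_left
      · rw [disjoint_left]
        intro z hz hzK
        simp only [mem_insert, mem_singleton] at hz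
        rcases hz with rfl | rfl
        · exact hxX (hKX _ hzK)
        · exact hyX (hKX _ hzK)
    · intro B hB
      by_contra hlt
      have hBg : ∀ x ∈ B, x ∈ C.ground ∧ x ∉ X := fun x hx => (hgr x).1 (hB.1 hx)
      have hBX : Disjoint X B := disjoint_right.2 (fun x hx => (hBg x hx).2)
      have hBh : C.Hits (B ∪ K !b) := by
        rw [← hits_minor_iff]
        · exact hB.2
        · exact disjoint_of_subset_right (hKX b) hBX.symm
      have hBsub : B ⊆ C.ground := fun x hx => (hBg x hx).1
      have h2 : ∀ Z ⊆ C.ground, Z.card < 2 → ¬ C.Hits Z := by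
        intro Z hZ hZc hZh
        have := hP.two_le_card Z ⟨hZ, hZh⟩
        omega
      refine (hC.cleanOn.shift hBsub).not_cover_colour_class (E := E) (X := X) (c := c) (b := !b)
        ?_ ?_ ?_ ?_ hXE hc ?_ ?_
      · exact fun x hx => mem_sdiff.2 ⟨hXg hx, disjoint_left.1 hBX hx⟩
      · rw [empty_union]
        exact h2 B hBsub (by omega)
      · intro x hx hh
        have hxB : C.IsCover ({x} ∪ B) :=
          ⟨union_subset (singleton_subset_iff.2 (hXg hx)) hBsub, hh⟩
        have hcard := hP.two_le_card _ hxB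
        have hcard' := card_union_le {x} B
        rw [card_singleton] at hcard'
        obtain ⟨y, rfl⟩ := card_eq_one.1 (show B.card = 1 by omega)
        exact (hBg y (mem_singleton_self y)).2 (hXE x y hxB hx)
      · exact fun x y hxy => Hits.mono hxy.2 subset_union_left
      · intro x hx y hy
        obtain ⟨n, hn⟩ := hconn x hx
        obtain ⟨m, hm⟩ := hconn y hy
        exact ⟨n + m, (hn.symm hEsymm).trans hm⟩
      · rw [union_comm]
        exact hBh
  refine ⟨K true, K false, ⟨(hKX _).trans hXg, (hKX _).trans hXg, hKdis true, hforced true,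
    hforced false, hclean true, hclean false, hpre true, hpre false⟩, ?_, ?_, ?_⟩
  · exact mem_filter.2 ⟨hvX, (hct v).2 ⟨0, Even.zero, WalkOfLength.refl v⟩⟩
  · obtain ⟨y, hy⟩ := hP.exists_pair v hv
    refine ⟨y, mem_filter.2 ⟨hXE v y hy hvX, ?_⟩⟩
    have h1 := hc v hvX y hy
    rw [(hct v).2 ⟨0, Even.zero, WalkOfLength.refl v⟩] at h1
    exact Bool.eq_not.2 h1.symm
  · intro u hu
    rw [mem_union, show u ∈ K true ∨ u ∈ K false ↔ u ∈ X from hKunion true u, hX, mem_filter]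
    exact and_iff_right hu

end Split

end Clutter

/-! ### Fractional packings of value two -/

namespace Clutter

section Packing

variable {α : Type*} [DecidableEq α]

/-- A fractional packing of value two. -/
def IsPackingTwo (C : Clutter α) (y : Finset α → ℝ) : Prop :=
  C.IsFractionalPacking y ∧ C.packingValue y = 2

theorem mem_core_iff {C : Clutter α} {A : Finset α} :
    A ∈ C.core.members ↔ A ∈ C.members ∧ ∃ y, C.IsPackingTwo y ∧ 0 < y A := by
  simp [core, IsPackingTwo, and_assoc]

theorem sum_filter_mem_eq_sum_mul (C : Clutter α) (y : Finset α → ℝ) (v : α) :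
    ∑ A ∈ C.members with v ∈ A, y A = ∑ A ∈ C.members, y A * (if v ∈ A then 1 else 0) := by
  rw [sum_filter]
  exact sum_congr rfl (fun A _ => by split_ifs <;> simp)

/-- Complementary slackness: a member used by a packing of value two meets every two-element cover
exactly once. -/
theorem IsPackingTwo.mem_iff_notMem {C : Clutter α} {y : Finset α → ℝ} (hy : C.IsPackingTwo y)
    {u v : α} (huv : C.IsCover {u, v}) {A : Finset α} (hA : A ∈ C.members) (hyA : 0 < y A) :
    u ∈ A ↔ v ∉ A := by
  have hmeet : ∀ B ∈ C.members, u ∈ B ∨ v ∈ B := by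
    intro B hB
    obtain ⟨x, hx⟩ := huv.2 B hB
    simp only [mem_inter, mem_insert, mem_singleton] at hx
    rcases hx with ⟨hxB, rfl | rfl⟩
    · exact Or.inl hxB
    · exact Or.inr hxB
  have hu := hy.1.2 u (huv.1 (by simp))
  have hv := hy.1.2 v (huv.1 (by simp))
  have h2 := hy.2
  rw [packingValue] at h2
  rw [sum_filter_mem_eq_sum_mul] at hu hv
  have hnn : ∀ B ∈ C.members,
      0 ≤ y B * ((if u ∈ B then 1 else 0) + (if v ∈ B then 1 else 0) - 1) := by
    intro B hB
    have := hmeet B hB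
    refine mul_nonneg (hy.1.1 B hB) ?_
    split_ifs <;> first | (exfalso; tauto) | norm_num
  have hle : ∑ B ∈ C.members, y B * ((if u ∈ B then 1 else 0) + (if v ∈ B then 1 else 0) - 1)
      ≤ 0 := by
    simp only [mul_sub, mul_add, sum_sub_distrib, sum_add_distrib, mul_one]
    linarith
  have h0 := (sum_eq_zero_iff_of_nonneg hnn).1 (le_antisymm hle (sum_nonneg hnn)) A hA
  have h1 := (mul_eq_zero.1 h0).resolve_left hyA.ne'
  have := hmeet A hA
  by_cases huA : u ∈ A <;> by_cases hvA : v ∈ A <;> simp_all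

theorem mem_iff_notMem_of_mem_core {C : Clutter α} {u v : α} (huv : C.IsCover {u, v})
    {A : Finset α} (hA : A ∈ C.core.members) : u ∈ A ↔ v ∉ A := by
  obtain ⟨hA, y, hy, hyA⟩ := mem_core_iff.1 hA
  exact hy.mem_iff_notMem huv hA hyA

/-- Connected elements agree on all core members or disagree on all of them. -/
theorem Conn.agree_or_disagree {C : Clutter α} {u v : α} (h : C.Conn u v) :
    (∀ A ∈ C.core.members, v ∈ A ↔ u ∈ A) ∨ (∀ A ∈ C.core.members, v ∈ A ↔ u ∉ A) := by
  induction h with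
  | refl => exact Or.inl (fun _ _ => Iff.rfl)
  | tail _ hE ih =>
    rcases ih with ih | ih
    · right
      intro A hA
      have h1 := ih A hA
      have h2 := mem_iff_notMem_of_mem_core hE hA
      tauto
    · left
      intro A hA
      have h1 := ih A hA
      have h2 := mem_iff_notMem_of_mem_core hE hA
      tauto

theorem IsPackingTwo.sum_eq_one {C : Clutter α} (hP : C.IsPretangled) {y : Finset α → ℝ}
    (hy : C.IsPackingTwo y) {v : α} (hv : v ∈ C.ground) :
    ∑ A ∈ C.members with v ∈ A, y A = 1 := by
  refine le_antisymm (hy.1.2 v hv) ?_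
  obtain ⟨u, huv⟩ := hP.exists_pair v hv
  have hu := hy.1.2 u (huv.1 (by simp))
  have h2 := hy.2
  rw [packingValue] at h2
  rw [sum_filter_mem_eq_sum_mul] at hu ⊢
  have : ∑ A ∈ C.members, y A ≤ ∑ A ∈ C.members, (y A * (if v ∈ A then 1 else 0) +
      y A * (if u ∈ A then 1 else 0)) := by
    refine sum_le_sum (fun A hA => ?_)
    obtain ⟨x, hx⟩ := huv.2 A hA
    have hyA := hy.1.1 A hA
    simp only [mem_inter, mem_insert, mem_singleton] at hx
    rcases hx with ⟨hxA, rfl | rfl⟩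
    · simp only [hxA, if_true, mul_one]
      split_ifs <;> simp [hyA]
    · simp only [hxA, if_true, mul_one]
      split_ifs <;> simp [hyA]
  rw [sum_add_distrib] at this
  linarith

/-- Weights on the minor deleting `U'` and contracting `U`, as weights on the members of the
original clutter that avoid `U'`. -/
def liftWeight (U U' : Finset α) (z : Finset α → ℝ) (A : Finset α) : ℝ :=
  if A ∩ U' = ∅ then z (A \ U) else 0

namespace IsSplit

variable {C : Clutter α} {U U' : Finset α}

theorem mem_minor_ground (_ : C.IsSplit U U') {u : α} :
    u ∈ (C.minor U' U).ground ↔ u ∈ C.ground ∧ u ∉ U ∪ U' := by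
  simp only [minor, mem_sdiff, mem_union]
  tauto

theorem minor_members (h : C.IsSplit U U') :
    (C.minor U' U).members = (C.members.filter (fun A => A ∩ U' = ∅)).image (fun A => A \ U) := by
  refine filter_eq_self.2 ?_
  intro A₀ hA₀ B₀ hB₀ hBA
  obtain ⟨A, hAf, rfl⟩ := mem_image.1 hA₀
  obtain ⟨B, hBf, rfl⟩ := mem_image.1 hB₀
  obtain ⟨hA, hA'⟩ := mem_filter.1 hAf
  obtain ⟨hB, -⟩ := mem_filter.1 hBf
  have hUA := h.left_of_right A hA hA'
  have : B ⊆ A := by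
    intro x hx
    by_cases hxU : x ∈ U
    · exact hUA hxU
    · exact (mem_sdiff.1 (hBA (mem_sdiff.2 ⟨hx, hxU⟩))).1
  rw [C.antichain B hB A hA this]

theorem sum_liftWeight (h : C.IsSplit U U') (z g : Finset α → ℝ) :
    ∑ A ∈ C.members, liftWeight U U' z A * g A =
      ∑ B ∈ (C.minor U' U).members, z B * g (B ∪ U) := by
  have hUA : ∀ A ∈ C.members.filter (fun A => A ∩ U' = ∅), A \ U ∪ U = A := fun A hA =>
    sdiff_union_of_subset (h.left_of_right A (mem_filter.1 hA).1 (mem_filter.1 hA).2)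
  rw [h.minor_members, sum_image, sum_filter]
  · refine sum_congr rfl (fun A hA => ?_)
    unfold liftWeight
    split_ifs with hA'
    · rw [hUA A (mem_filter.2 ⟨hA, hA'⟩)]
    · rw [zero_mul]
  · intro A hA B hB hAB
    rw [← hUA A hA, ← hUA B hB]
    exact congrArg (· ∪ U) hAB

theorem sum_liftWeight_one (h : C.IsSplit U U') (z : Finset α → ℝ) :
    ∑ A ∈ C.members, liftWeight U U' z A = ∑ B ∈ (C.minor U' U).members, z B := by
  simpa using h.sum_liftWeight z (fun _ => 1)

theorem sum_liftWeight_left (h : C.IsSplit U U') (z : Finset α → ℝ) {u : α} (hu : u ∈ U) :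
    ∑ A ∈ C.members with u ∈ A, liftWeight U U' z A = ∑ B ∈ (C.minor U' U).members, z B := by
  rw [sum_filter_mem_eq_sum_mul, h.sum_liftWeight]
  simp [hu]

theorem sum_liftWeight_right (z : Finset α → ℝ) {u : α} (hu : u ∈ U') :
    ∑ A ∈ C.members with u ∈ A, liftWeight U U' z A = 0 := by
  refine sum_eq_zero (fun A hA => ?_)
  refine if_neg (nonempty_iff_ne_empty.1 ⟨u, mem_inter.2 ⟨(mem_filter.1 hA).2, hu⟩⟩)

theorem sum_liftWeight_outside (h : C.IsSplit U U') (z : Finset α → ℝ) {u : α}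
    (hu : u ∉ U ∪ U') : ∑ A ∈ C.members with u ∈ A, liftWeight U U' z A =
      ∑ B ∈ (C.minor U' U).members with u ∈ B, z B := by
  rw [sum_filter_mem_eq_sum_mul, h.sum_liftWeight, sum_filter_mem_eq_sum_mul]
  rw [mem_union, not_or] at hu
  simp [hu.1]

theorem liftWeight_nonneg (h : C.IsSplit U U') {z : Finset α → ℝ}
    (hz : ∀ B ∈ (C.minor U' U).members, 0 ≤ z B) {A : Finset α} (hA : A ∈ C.members) :
    0 ≤ liftWeight U U' z A := by
  unfold liftWeight
  split_ifs with hA'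
  · refine hz _ ?_
    rw [h.minor_members]
    exact mem_image_of_mem (fun A => A \ U) (mem_filter (p := fun A => A ∩ U' = ∅) |>.2 ⟨hA, hA'⟩)
  · exact le_rfl

/-- Averaging packings of the two minors gives a packing: on the split component each class
receives half of the total weight two. -/
theorem isPackingTwo_average (h : C.IsSplit U U') {z z' : Finset α → ℝ}
    (hz : (C.minor U' U).IsPackingTwo z) (hz' : (C.minor U U').IsPackingTwo z') :
    C.IsPackingTwo (fun A => (liftWeight U U' z A + liftWeight U' U z' A) / 2) := by
  have hz2 : ∑ B ∈ (C.minor U' U).members, z B = 2 := hz.2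
  have hz2' : ∑ B ∈ (C.minor U U').members, z' B = 2 := hz'.2
  refine ⟨⟨fun A hA => ?_, fun v hv => ?_⟩, ?_⟩
  · have h1 := h.liftWeight_nonneg hz.1.1 hA
    have h2 := h.symm.liftWeight_nonneg hz'.1.1 hA
    positivity
  · rw [← sum_div, sum_add_distrib]
    by_cases hvU : v ∈ U
    · rw [h.sum_liftWeight_left z hvU, sum_liftWeight_right z' hvU, hz2]
      norm_num
    · by_cases hvU' : v ∈ U'
      · rw [sum_liftWeight_right z hvU', h.symm.sum_liftWeight_left z' hvU', hz2']
        norm_num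
      · have hvX : v ∉ U ∪ U' := by simp [hvU, hvU']
        have hvX' : v ∉ U' ∪ U := by simp [hvU, hvU']
        rw [h.sum_liftWeight_outside z hvX, h.symm.sum_liftWeight_outside z' hvX']
        have h1 := hz.1.2 v (h.mem_minor_ground.2 ⟨hv, hvX⟩)
        have h2 := hz'.1.2 v (h.symm.mem_minor_ground.2 ⟨hv, hvX'⟩)
        linarith
  · rw [packingValue, ← sum_div, sum_add_distrib, h.sum_liftWeight_one, h.symm.sum_liftWeight_one,
      hz2, hz2']
    norm_num

end IsSplit

/-- A clean pretangled clutter has a fractional packing of value two. -/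
theorem exists_isPackingTwo {C : Clutter α} (hC : C.IsClean) (hP : C.IsPretangled) :
    ∃ y, C.IsPackingTwo y := by
  induction hn : C.ground.card using Nat.strong_induction_on generalizing C with
  | _ n ih =>
  rcases C.ground.eq_empty_or_nonempty with h0 | ⟨v, hv⟩
  · have hm : C.members = {∅} := by
      have hsub : ∀ A ∈ C.members, A = ∅ := fun A hA =>
        subset_empty.1 (h0 ▸ C.subset_ground A hA)
      refine (subset_singleton_iff.1 (fun A hA => mem_singleton.2 (hsub A hA))).resolve_left ?_
      intro hemp
      have := hP.two_le_card ∅ ⟨empty_subset _, fun A hA => by simp [hemp] at hA⟩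
      simp at this
    refine ⟨fun _ => 2, ⟨fun _ _ => by norm_num, fun v hv => ?_⟩, ?_⟩
    · rw [h0] at hv
      exact absurd hv (notMem_empty v)
    · simp [packingValue, hm]
  · obtain ⟨U, U', h, hvU, -, -⟩ := exists_isSplit hC hP hv
    have hlt : ∀ I J : Finset α, v ∈ I ∪ J → (C.minor I J).ground.card < n := by
      intro I J hvIJ
      rw [← hn]
      exact card_lt_card ⟨sdiff_subset, fun hs => (mem_sdiff.1 (hs hv)).2 hvIJ⟩
    obtain ⟨z, hz⟩ := ih _ (hlt U' U (mem_union_right _ hvU)) h.clean_left h.pre_left rfl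
    obtain ⟨z', hz'⟩ := ih _ (hlt U U' (mem_union_left _ hvU)) h.clean_right h.pre_right rfl
    exact ⟨_, h.isPackingTwo_average hz hz'⟩

/-- Weights of total value two on core members that give weight one to each element outside `T`. -/
structure IsBalancedOutside (C : Clutter α) (y : Finset α → ℝ) (T : α → Prop) : Prop where
  nonneg : ∀ A ∈ C.members, 0 ≤ y A
  value : ∑ A ∈ C.members, y A = 2
  core : ∀ A ∈ C.members, y A ≠ 0 → A ∈ C.core.members
  sum_eq_one : ∀ u ∈ C.ground, ¬ T u → ∑ A ∈ C.members with u ∈ A, y A = 1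

theorem IsPackingTwo.isBalancedOutside {C : Clutter α} (hP : C.IsPretangled) {y : Finset α → ℝ}
    (hy : C.IsPackingTwo y) : C.IsBalancedOutside y (fun _ => False) where
  nonneg := hy.1.1
  value := hy.2
  core A hA hyA := mem_core_iff.2 ⟨hA, y, hy, lt_of_le_of_ne (hy.1.1 A hA) hyA.symm⟩
  sum_eq_one _ hu _ := hy.sum_eq_one hP hu

theorem IsSplit.isBalancedOutside_liftWeight {C : Clutter α} {U U' : Finset α}
    (h : C.IsSplit U U') {z : Finset α → ℝ} {T : α → Prop}
    (hz : (C.minor U' U).IsBalancedOutside z T) :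
    C.IsBalancedOutside (liftWeight U U' z) (fun u => u ∈ U ∪ U' ∨ T u) where
  nonneg _ hA := h.liftWeight_nonneg hz.nonneg hA
  value := by rw [h.sum_liftWeight_one, hz.value]
  core A hA hyA := by
    have hA' : A ∩ U' = ∅ := by
      by_contra hcon
      exact hyA (if_neg hcon)
    have hAm : A \ U ∈ (C.minor U' U).members := by
      rw [h.minor_members]
      exact mem_image_of_mem (fun A => A \ U)
        (mem_filter (p := fun A => A ∩ U' = ∅) |>.2 ⟨hA, hA'⟩)
    have hzA : z (A \ U) ≠ 0 := by
      rwa [liftWeight, if_pos hA'] at hyA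
    obtain ⟨-, z₁, hz₁, hpos⟩ := mem_core_iff.1 (hz.core _ hAm hzA)
    obtain ⟨z₂, hz₂⟩ := exists_isPackingTwo h.clean_right h.pre_right
    refine mem_core_iff.2 ⟨hA, _, h.isPackingTwo_average hz₁ hz₂, ?_⟩
    have := h.symm.liftWeight_nonneg hz₂.1.1 hA
    have h1 : 0 < liftWeight U U' z₁ A := by rwa [liftWeight, if_pos hA']
    positivity
  sum_eq_one u hu hT := by
    rw [not_or] at hT
    rw [h.sum_liftWeight_outside z hT.1]
    exact hz.sum_eq_one u (h.mem_minor_ground.2 ⟨hu, hT.1⟩) hT.2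

theorem IsBalancedOutside.mono {C : Clutter α} {y : Finset α → ℝ} {T T' : α → Prop}
    (hy : C.IsBalancedOutside y T) (h : ∀ u ∈ C.ground, T u → T' u) : C.IsBalancedOutside y T' :=
  ⟨hy.nonneg, hy.value, hy.core, fun u hu hT => hy.sum_eq_one u hu (fun hT' => hT (h u hu hT'))⟩

theorem IsSplit.mem_iff_of_liftWeight_ne_zero {C : Clutter α} {U U' : Finset α}
    (h : C.IsSplit U U') {z : Finset α → ℝ} {A : Finset α} (hA : A ∈ C.members)
    (hne : liftWeight U U' z A ≠ 0) : U ⊆ A ∧ A ∩ U' = ∅ ∧ z (A \ U) ≠ 0 := by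
  have hA' : A ∩ U' = ∅ := by
    by_contra hcon
    exact hne (if_neg hcon)
  refine ⟨h.left_of_right A hA hA', hA', ?_⟩
  rwa [liftWeight, if_pos hA'] at hne

/-- For every element `v` there are weights supported on the core members containing (resp.
avoiding) `v` that are balanced outside the component of `v`. In the setcore, this says that the
point with one coordinate `0` or `1` and all others `1/2` lies in the convex hull. -/
theorem exists_isBalancedOutside {C : Clutter α} (hC : C.IsClean) (hP : C.IsPretangled) {v : α}
    (hv : v ∈ C.ground) (b : Prop) : ∃ y, C.IsBalancedOutside y (C.Conn v) ∧
      ∀ A ∈ C.members, y A ≠ 0 → (v ∈ A ↔ b) := by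
  obtain ⟨U, U', h, hvU, -, hconn⟩ := exists_isSplit hC hP hv
  by_cases hb : b
  · obtain ⟨z, hz⟩ := exists_isPackingTwo h.clean_left h.pre_left
    refine ⟨_, (h.isBalancedOutside_liftWeight (hz.isBalancedOutside h.pre_left)).mono ?_, ?_⟩
    · intro u hu hT
      exact (hconn u hu).1 (hT.resolve_right id)
    · intro A hA hne
      exact iff_of_true ((h.mem_iff_of_liftWeight_ne_zero hA hne).1 hvU) hb
  · obtain ⟨z, hz⟩ := exists_isPackingTwo h.clean_right h.pre_right
    refine ⟨_, (h.symm.isBalancedOutside_liftWeight (hz.isBalancedOutside h.pre_right)).mono ?_, ?_⟩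
    · intro u hu hT
      rw [union_comm] at hT
      exact (hconn u hu).1 (hT.resolve_right id)
    · intro A hA hne
      refine iff_of_false (fun hvA => ?_) hb
      have := (h.symm.mem_iff_of_liftWeight_ne_zero hA hne).2.1
      have hmem : v ∈ A ∩ U := mem_inter.2 ⟨hvA, hvU⟩
      rw [this] at hmem
      exact notMem_empty _ hmem

/-- Suppose the packing of value two is unique, and `v`, `w` lie in different components. In the
minor fixing the component of `v`, either the component of `w` merges with another one, so that some
`u` in a third component agrees or disagrees with `w` on all core members containing `v`, or it
does not, and there are balanced weights supported on the core members with prescribed `v`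
and `w`. -/
theorem merge_or_exists_isBalancedOutside {C : Clutter α} (hC : C.IsClean) (hP : C.IsPretangled)
    (huniq : ∀ y y', C.IsPackingTwo y → C.IsPackingTwo y' → ∀ A ∈ C.members, y A = y' A)
    {v w : α} (hv : v ∈ C.ground) (hw : w ∈ C.ground) (hvw : ¬ C.Conn v w) :
    (∃ u ∈ C.ground, ¬ C.Conn v u ∧ ¬ C.Conn w u ∧
      ((∀ A ∈ C.core.members, v ∈ A → (u ∈ A ↔ w ∈ A)) ∨
        (∀ A ∈ C.core.members, v ∈ A → (u ∈ A ↔ w ∉ A)))) ∨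
    ∀ b : Prop, ∃ y, C.IsBalancedOutside y (fun u => C.Conn v u ∨ C.Conn w u) ∧
      ∀ A ∈ C.members, y A ≠ 0 → v ∈ A ∧ (w ∈ A ↔ b) := by
  obtain ⟨U, U', h, hvU, -, hconn⟩ := exists_isSplit hC hP hv
  have hwX : w ∉ U ∪ U' := fun hw' => hvw ((hconn w hw).1 hw')
  by_cases hmerge : ∃ u ∈ (C.minor U' U).ground, (C.minor U' U).Conn w u ∧ ¬ C.Conn w u
  · left
    obtain ⟨u, hu, hwu, hwu'⟩ := hmerge
    obtain ⟨hug, huX⟩ := h.mem_minor_ground.1 hu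
    refine ⟨u, hug, fun hvu => huX ((hconn u hug).2 hvu), hwu', ?_⟩
    have hcore : ∀ A ∈ C.core.members, v ∈ A → A \ U ∈ (C.minor U' U).core.members := by
      intro A hA hvA
      obtain ⟨hA, y, hy, hyA⟩ := mem_core_iff.1 hA
      obtain ⟨z, hz⟩ := exists_isPackingTwo h.clean_left h.pre_left
      obtain ⟨z', hz'⟩ := exists_isPackingTwo h.clean_right h.pre_right
      have heq := huniq _ _ hy (h.isPackingTwo_average hz hz') A hA
      have h0 : liftWeight U' U z' A = 0 := by
        refine if_neg (nonempty_iff_ne_empty.1 ⟨v, mem_inter.2 ⟨hvA, hvU⟩⟩)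
      rw [h0] at heq
      have hpos : 0 < liftWeight U U' z A := by linarith
      have hA' := (h.mem_iff_of_liftWeight_ne_zero hA hpos.ne').2.1
      rw [liftWeight, if_pos hA'] at hpos
      refine mem_core_iff.2 ⟨?_, z, hz, hpos⟩
      rw [h.minor_members]
      exact mem_image_of_mem (fun A => A \ U)
        (mem_filter (p := fun A => A ∩ U' = ∅) |>.2 ⟨hA, hA'⟩)
    have huU : u ∉ U := fun hu' => huX (mem_union_left _ hu')
    have hwU : w ∉ U := fun hw' => hwX (mem_union_left _ hw')
    refine hwu.agree_or_disagree.imp (fun hag A hA hvA => ?_) (fun hag A hA hvA => ?_)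
    · simpa [huU, hwU] using hag _ (hcore A hA hvA)
    · simpa [huU, hwU] using hag _ (hcore A hA hvA)
  · right
    intro b
    push Not at hmerge
    obtain ⟨z, hz, hzw⟩ := exists_isBalancedOutside h.clean_left h.pre_left
      (h.mem_minor_ground.2 ⟨hw, hwX⟩) b
    refine ⟨_, (h.isBalancedOutside_liftWeight hz).mono ?_, ?_⟩
    · intro u hu hT
      by_cases huX : u ∈ U ∪ U'
      · exact Or.inl ((hconn u hu).1 huX)
      · exact Or.inr (hmerge u (h.mem_minor_ground.2 ⟨hu, huX⟩) (hT.resolve_left huX))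
    · intro A hA hne
      obtain ⟨hUA, hA', hzA⟩ := h.mem_iff_of_liftWeight_ne_zero hA hne
      have hAm : A \ U ∈ (C.minor U' U).members := by
        rw [h.minor_members]
        exact mem_image_of_mem (fun A => A \ U)
          (mem_filter (p := fun A => A ∩ U' = ∅) |>.2 ⟨hA, hA'⟩)
      have hwU : w ∉ U := fun hw' => hwX (mem_union_left _ hw')
      refine ⟨hUA hvU, ?_⟩
      simpa [hwU] using hzw _ hAm hzA

end Packing

end Clutter

/-! ### Affine independence of 0-1 points in terms of signs -/

section SignedPoints

variable {ι : Type*}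

/-- The sign `(-1)ˣ` of a bit. -/
def bitSign (x : ZMod 2) : ℝ := 1 - 2 * (x.val : ℝ)

theorem zmod_two_cases (x : ZMod 2) : x = 0 ∨ x = 1 := by
  revert x
  decide

@[simp] theorem bitSign_zero : bitSign 0 = 1 := by simp [bitSign]

@[simp] theorem bitSign_one : bitSign 1 = -1 := by
  rw [bitSign, show (1 : ZMod 2).val = 1 from rfl]
  norm_num

theorem bitSign_add (x y : ZMod 2) : bitSign (x + y) = bitSign x * bitSign y := by
  rcases zmod_two_cases x with rfl | rfl <;> rcases zmod_two_cases y with rfl | rfl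
  · simp
  · simp
  · simp
  · rw [show (1 : ZMod 2) + 1 = 0 from rfl]
    simp

theorem bitSign_mul_self (x : ZMod 2) : bitSign x * bitSign x = 1 := by
  rcases zmod_two_cases x with rfl | rfl <;> simp

theorem bitSign_injective : Function.Injective bitSign := by
  intro x y h
  rcases zmod_two_cases x with rfl | rfl <;> rcases zmod_two_cases y with rfl | rfl
  · rfl
  · norm_num at h
  · norm_num at h
  · rfl

theorem toRealPoint_eq (p : ι → ZMod 2) (i : ι) : toRealPoint p i = (1 - bitSign (p i)) / 2 := by
  simp [toRealPoint, bitSign]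

theorem toRealPoint_injective : Function.Injective (toRealPoint (ι := ι)) := by
  intro p q h
  funext i
  apply bitSign_injective
  have := congrFun h i
  rw [toRealPoint_eq, toRealPoint_eq] at this
  linarith

/-- Affine independence of a set of `0-1` points, in terms of their `±1` vectors: no nonzero weights
are orthogonal to the constants and to every coordinate sign. -/
def SignIndependent (S : Finset (ι → ZMod 2)) : Prop :=
  ∀ f : (ι → ZMod 2) → ℝ, ∑ p ∈ S, f p = 0 → (∀ i, ∑ p ∈ S, f p * bitSign (p i) = 0) →
    ∀ p ∈ S, f p = 0

theorem affineIndependent_iff_signIndependent (S : Finset (ι → ZMod 2)) :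
    AffineIndependent ℝ (fun p : S => toRealPoint (p : ι → ZMod 2)) ↔ SignIndependent S := by
  classical
  have hcoord : ∀ f : (ι → ZMod 2) → ℝ, ∑ p ∈ S, f p = 0 → ∀ i,
      (∑ p ∈ S, f p • toRealPoint p) i = -(∑ p ∈ S, f p * bitSign (p i)) / 2 := by
    intro f hf i
    rw [Finset.sum_apply]
    have : ∀ p ∈ S, (f p • toRealPoint p) i = f p * (1 / 2) - f p * bitSign (p i) * (1 / 2) := by
      intro p _
      rw [Pi.smul_apply, smul_eq_mul, toRealPoint_eq]
      ring
    rw [sum_congr rfl this, sum_sub_distrib, ← sum_mul, ← sum_mul, hf]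
    ring
  rw [affineIndependent_iff_of_fintype]
  constructor
  · intro h f hf hfs p hp
    refine h (fun p => f p) (by rw [← hf]; exact sum_coe_sort S f) ?_ ⟨p, hp⟩
    rw [weightedVSub_eq_linear_combination univ (by rw [← hf]; exact sum_coe_sort S f)]
    rw [sum_coe_sort S (fun p => f p • toRealPoint p)]
    funext i
    rw [hcoord f hf i, hfs i]
    simp
  · intro h w hw hws p
    set f : (ι → ZMod 2) → ℝ := fun p => if hp : p ∈ S then w ⟨p, hp⟩ else 0 with hfdef
    have hfw : ∀ p : S, f p = w p := fun p => by simp [hfdef]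
    have hf : ∑ p ∈ S, f p = 0 := by
      rw [← sum_coe_sort, ← hw]
      exact sum_congr rfl (fun p _ => hfw p)
    rw [← hfw p]
    refine h f hf (fun i => ?_) p p.2
    rw [weightedVSub_eq_linear_combination univ hw] at hws
    have h0 : ∑ p ∈ S, f p • toRealPoint p = 0 := by
      rw [← sum_coe_sort, ← hws]
      exact sum_congr rfl (fun p _ => by rw [hfw p])
    have := hcoord f hf i
    rw [h0] at this
    simp only [Pi.zero_apply] at this
    linarith

/-- The `0-1` points of `S` are vertices of their convex hull. -/
theorem toRealPoint_mem_extremePoints {S : Finset (ι → ZMod 2)} {p : ι → ZMod 2} (hp : p ∈ S) :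
    toRealPoint p ∈ (convPoints S).extremePoints ℝ := by
  have hcube : ∀ x ∈ convPoints S, ∀ i, 0 ≤ x i ∧ x i ≤ 1 := by
    have hsub : convPoints S ⊆ Set.Icc (0 : ι → ℝ) 1 := by
      refine convexHull_min ?_ (convex_Icc 0 1)
      rintro _ ⟨q, -, rfl⟩
      constructor <;> intro i <;> rcases zmod_two_cases (q i) with h | h <;>
        simp [toRealPoint_eq, h]
    exact fun x hx i => ⟨(hsub hx).1 i, (hsub hx).2 i⟩
  rw [mem_extremePoints]
  refine ⟨subset_convexHull ℝ _ ⟨p, hp, rfl⟩, fun x hx y hy hxy => ?_⟩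
  obtain ⟨a, b, ha, hb, hab, heq⟩ := hxy
  have key : ∀ i, x i = toRealPoint p i ∧ y i = toRealPoint p i := by
    intro i
    have hi := congrFun heq i
    simp only [Pi.add_apply, Pi.smul_apply, smul_eq_mul] at hi
    obtain ⟨hx0, hx1⟩ := hcube x hx i
    obtain ⟨hy0, hy1⟩ := hcube y hy i
    rw [toRealPoint_eq] at hi ⊢
    rcases zmod_two_cases (p i) with h | h
    · rw [h, bitSign_zero] at hi ⊢
      have h1 : a * x i = 0 := by nlinarith [mul_nonneg ha.le hx0, mul_nonneg hb.le hy0]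
      have h2 : b * y i = 0 := by nlinarith [mul_nonneg ha.le hx0, mul_nonneg hb.le hy0]
      rw [(mul_eq_zero.1 h1).resolve_left ha.ne', (mul_eq_zero.1 h2).resolve_left hb.ne']
      norm_num
    · rw [h, bitSign_one] at hi ⊢
      have hx' := mul_nonneg ha.le (sub_nonneg.2 hx1)
      have hy' := mul_nonneg hb.le (sub_nonneg.2 hy1)
      have h1 : a * (1 - x i) = 0 := by nlinarith
      have h2 : b * (1 - y i) = 0 := by nlinarith
      have h3 := (mul_eq_zero.1 h1).resolve_left ha.ne'
      have h4 := (mul_eq_zero.1 h2).resolve_left hb.ne'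
      constructor <;> linarith
  exact ⟨funext (fun i => (key i).1), funext (fun i => (key i).2)⟩

theorem SignIndependent.of_isSimplex {S : Finset (ι → ZMod 2)} (h : IsSimplex (convPoints S)) :
    SignIndependent S := by
  obtain ⟨m, s, hs⟩ := h
  rw [← affineIndependent_iff_signIndependent]
  have hex : ∀ p : S, ∃ j, s.points j = toRealPoint (p : ι → ZMod 2) := by
    intro p
    have h1 := toRealPoint_mem_extremePoints p.2
    rw [hs] at h1
    obtain ⟨j, hj⟩ := extremePoints_convexHull_subset h1
    exact ⟨j, hj⟩
  choose j hj using hex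
  have hinj : Function.Injective j := by
    intro p q hpq
    apply Subtype.ext
    apply toRealPoint_injective
    rw [← hj p, ← hj q, hpq]
  have := s.independent.comp_embedding ⟨j, hinj⟩
  convert this using 1
  funext p
  exact (hj p).symm

theorem SignIndependent.isSimplex {S : Finset (ι → ZMod 2)} (h : SignIndependent S)
    (hS : S.Nonempty) : IsSimplex (convPoints S) := by
  have hcard : S.card = S.card - 1 + 1 := by
    have := hS.card_pos
    omega
  let e : Fin (S.card - 1 + 1) ≃ S := (finCongr hcard.symm).trans S.equivFin.symm
  refine ⟨S.card - 1, ⟨fun j => toRealPoint (e j : ι → ZMod 2),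
    ((affineIndependent_iff_signIndependent S).2 h).comp_embedding e.toEmbedding⟩, ?_⟩
  rw [convPoints]
  congr 1
  ext x
  constructor
  · rintro ⟨p, hp, rfl⟩
    exact ⟨e.symm ⟨p, hp⟩, by simp⟩
  · rintro ⟨j, rfl⟩
    exact ⟨e j, (e j).2, rfl⟩

/-- In an affinely independent set every function is the restriction of an affine function. -/
theorem SignIndependent.exists_affine [Fintype ι] {S : Finset (ι → ZMod 2)}
    (h : SignIndependent S) (g : (ι → ZMod 2) → ℝ) :
    ∃ (a₀ : ℝ) (a : ι → ℝ), ∀ p ∈ S, g p = a₀ + ∑ i, a i * bitSign (p i) := by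
  classical
  let T : (S → ℝ) →ₗ[ℝ] (Option ι → ℝ) :=
    { toFun := fun f o => ∑ p : S, f p * o.elim 1 (fun i => bitSign ((p : ι → ZMod 2) i))
      map_add' := by
        intro f f'
        funext o
        simp [add_mul, sum_add_distrib]
      map_smul' := by
        intro c f
        funext o
        simp [mul_assoc, mul_sum] }
  have hT : Function.Injective T := by
    rw [← LinearMap.ker_eq_bot, LinearMap.ker_eq_bot']
    intro f hf
    set f' : (ι → ZMod 2) → ℝ := fun p => if hp : p ∈ S then f ⟨p, hp⟩ else 0 with hf'
    have hff : ∀ p : S, f' p = f p := fun p => by simp [hf']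
    funext p
    rw [← hff p]
    refine h f' ?_ (fun i => ?_) p p.2
    · rw [← sum_coe_sort]
      have := congrFun hf none
      simp only [T, LinearMap.coe_mk, AddHom.coe_mk, Option.elim_none, mul_one,
        Pi.zero_apply] at this
      rw [← this]
      exact sum_congr rfl (fun p _ => hff p)
    · rw [← sum_coe_sort]
      have := congrFun hf (some i)
      simp only [T, LinearMap.coe_mk, AddHom.coe_mk, Option.elim_some, Pi.zero_apply] at this
      rw [← this]
      exact sum_congr rfl (fun p _ => by rw [hff p])
  let φ : Module.Dual ℝ (S → ℝ) := ∑ p : S, g p • LinearMap.proj p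
  obtain ⟨ψ, hψ⟩ := LinearMap.dualMap_surjective_of_injective hT φ
  refine ⟨ψ (Pi.single none 1), fun i => ψ (Pi.single (some i) 1), fun p hp => ?_⟩
  have h1 := LinearMap.congr_fun hψ (Pi.single ⟨p, hp⟩ 1)
  have h2 : φ (Pi.single ⟨p, hp⟩ 1) = g p := by
    simp only [φ, LinearMap.sum_apply, LinearMap.smul_apply, LinearMap.proj_apply, smul_eq_mul]
    rw [sum_eq_single ⟨p, hp⟩]
    · simp
    · intro q _ hq
      simp [hq]
    · simp
  rw [h2, LinearMap.dualMap_apply, LinearMap.pi_apply_eq_sum_univ ψ, Fintype.sum_option] at h1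
  have h3 : ∀ o : Option ι, T (Pi.single ⟨p, hp⟩ 1) o = o.elim 1 (fun i => bitSign (p i)) := by
    intro o
    simp only [T, LinearMap.coe_mk, AddHom.coe_mk]
    rw [sum_eq_single ⟨p, hp⟩]
    · simp
    · intro q _ hq
      simp [hq]
    · simp
  rw [← h1, h3]
  simp only [h3, Option.elim_none, Option.elim_some, smul_eq_mul]
  congr 1
  · rw [one_mul]
    congr 1
    funext o
    cases o <;> simp
  · refine sum_congr rfl (fun i _ => ?_)
    rw [mul_comm]
    congr 2
    funext o
    cases o <;> simp [Pi.single_apply, eq_comm]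

end SignedPoints

/-! ### Balanced weights on 0-1 points -/

section BalancedPoints

variable {ι : Type*}

/-- Probability weights on `S` for which every coordinate outside `T` has mean `1/2`. -/
structure IsBalancedWeight (S : Finset (ι → ZMod 2)) (T : ι → Prop)
    (μ : (ι → ZMod 2) → ℝ) : Prop where
  nonneg : ∀ p ∈ S, 0 ≤ μ p
  total : ∑ p ∈ S, μ p = 1
  mean : ∀ j, ¬ T j → ∑ p ∈ S, μ p * bitSign (p j) = 0

/-- For every coordinate `i` and bit `b`, the point with coordinate `b` at `i` and `1/2` elsewhere is
in the convex hull of `S`. -/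
def HasFacetCenters (S : Finset (ι → ZMod 2)) : Prop :=
  ∀ i b, ∃ μ, IsBalancedWeight S (fun j => j = i) μ ∧ ∀ p ∈ S, μ p ≠ 0 → p i = b

theorem sum_mul_eq_of_support {S : Finset (ι → ZMod 2)} {μ f : (ι → ZMod 2) → ℝ} {c : ℝ}
    (hμ : ∑ p ∈ S, μ p = 1) (h : ∀ p ∈ S, μ p ≠ 0 → f p = c) : ∑ p ∈ S, μ p * f p = c := by
  rw [← one_mul c, ← hμ, sum_mul]
  refine sum_congr rfl (fun p hp => ?_)
  by_cases h0 : μ p = 0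
  · rw [h0, zero_mul, zero_mul]
  · rw [h p hp h0]

namespace HasFacetCenters

variable {S : Finset (ι → ZMod 2)}

theorem exists_apply_eq (h : HasFacetCenters S) (i : ι) (b : ZMod 2) : ∃ p ∈ S, p i = b := by
  obtain ⟨μ, hμ, hsupp⟩ := h i b
  have : ∃ p ∈ S, μ p ≠ 0 := by
    by_contra hcon
    push Not at hcon
    have := hμ.total
    rw [sum_eq_zero hcon] at this
    exact zero_ne_one this
  obtain ⟨p, hp, hne⟩ := this
  exact ⟨p, hp, hsupp p hp hne⟩

/-- No two coordinates agree up to a twist. -/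
theorem eq_of_add_const (h : HasFacetCenters S) {i j : ι} {c : ZMod 2}
    (hc : ∀ p ∈ S, p j = p i + c) : j = i := by
  by_contra hij
  obtain ⟨μ, hμ, hsupp⟩ := h i 0
  have h0 := hμ.mean j hij
  rw [sum_mul_eq_of_support (c := bitSign c) hμ.total] at h0
  · have := bitSign_mul_self c
    rw [h0] at this
    norm_num at this
  · intro p hp hne
    rw [hc p hp, hsupp p hp hne, zero_add]

/-- The functions `1` and `(-1)^(x i)` are linearly independent on `S`. -/
theorem card_lt_card [Fintype ι] [Nonempty ι] (h : HasFacetCenters S) :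
    Fintype.card ι < S.card := by
  let L : (Option ι → ℝ) →ₗ[ℝ] (S → ℝ) :=
    { toFun := fun a p => a none + ∑ i, a (some i) * bitSign ((p : ι → ZMod 2) i)
      map_add' := by
        intro a b
        funext p
        simp only [Pi.add_apply, add_mul, sum_add_distrib]
        ring
      map_smul' := by
        intro c a
        funext p
        simp [mul_add, mul_assoc, mul_sum] }
  have hL : Function.Injective L := by
    rw [← LinearMap.ker_eq_bot, LinearMap.ker_eq_bot']
    intro a ha
    have hS : ∀ p ∈ S, a none + ∑ i, a (some i) * bitSign (p i) = 0 := fun p hp =>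
      congrFun ha ⟨p, hp⟩
    have key : ∀ i b, a none + a (some i) * bitSign b = 0 := by
      intro i b
      obtain ⟨μ, hμ, hsupp⟩ := h i b
      have h0 : ∑ p ∈ S, μ p * (a none + ∑ j, a (some j) * bitSign (p j)) = 0 :=
        sum_eq_zero (fun p hp => by rw [hS p hp, mul_zero])
      have h1 : ∑ p ∈ S, μ p * (a none + ∑ j, a (some j) * bitSign (p j)) =
          (∑ p ∈ S, μ p) * a none + ∑ j, a (some j) * ∑ p ∈ S, μ p * bitSign (p j) := by
        simp only [mul_add, sum_add_distrib, sum_mul, mul_sum]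
        congr 1
        rw [sum_comm]
        exact sum_congr rfl (fun j _ => sum_congr rfl (fun p _ => by ring))
      rw [h1, hμ.total, one_mul, sum_eq_single i] at h0
      · rwa [sum_mul_eq_of_support (c := bitSign b) hμ.total] at h0
        exact fun p hp hne => by rw [hsupp p hp hne]
      · intro j _ hj
        rw [hμ.mean j hj, mul_zero]
      · simp
    funext o
    obtain ⟨i₀⟩ := ‹Nonempty ι›
    cases o with
    | none =>
      have h1 := key i₀ 0
      have h2 := key i₀ 1
      simp only [bitSign_zero, bitSign_one] at h1 h2
      change a none = 0
      linarith
    | some i =>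
      have h1 := key i 0
      have h2 := key i 1
      simp only [bitSign_zero, bitSign_one] at h1 h2
      change a (some i) = 0
      linarith
  have := LinearMap.finrank_le_finrank_of_injective hL
  simpa [Nat.succ_le_iff] using this

end HasFacetCenters

theorem IsBalancedWeight.eq_of_signIndependent {S : Finset (ι → ZMod 2)}
    (hS : SignIndependent S) {μ ν : (ι → ZMod 2) → ℝ}
    (hμ : IsBalancedWeight S (fun _ => False) μ) (hν : IsBalancedWeight S (fun _ => False) ν) :
    ∀ p ∈ S, μ p = ν p := by
  intro p hp
  have := hS (fun p => μ p - ν p) ?_ ?_ p hp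
  · linarith
  · rw [sum_sub_distrib, hμ.total, hν.total, sub_self]
  · intro i
    simp only [sub_mul]
    rw [sum_sub_distrib, hμ.mean i id, hν.mean i id, sub_self]

/-- In an affinely independent set with all facet centers, the coordinates are pairwise
independent for the unique weights representing the center of the cube. Expanding the product of
the signs of two coordinates `i`, `j` as an affine function, the coefficient at `j` vanishes, which
rules out weights that fix coordinate `i`, prescribe coordinate `j` and are balanced elsewhere.
Hence some third coordinate is tied to `j` once `i` is fixed, and by independence it is
the sum of both up to a constant. -/
theorem exists_eq_add_of_signIndependent [Fintype ι] {S : Finset (ι → ZMod 2)}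
    (hS : SignIndependent S) (hfacet : HasFacetCenters S)
    (hpos : ∀ p ∈ S, ∃ μ, IsBalancedWeight S (fun _ => False) μ ∧ 0 < μ p) {i j : ι}
    (halt : (∃ l, l ≠ i ∧ l ≠ j ∧ ∃ ε, ∀ p ∈ S, p i = 1 → p l = p j + ε) ∨
      ∀ b, ∃ μ, IsBalancedWeight S (fun l => l = i ∨ l = j) μ ∧
        ∀ p ∈ S, μ p ≠ 0 → p i = 1 ∧ p j = b) :
    ∃ l c, ∀ p ∈ S, p l = p i + p j + c := by
  obtain ⟨p₀, hp₀, -⟩ := hfacet.exists_apply_eq i 0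
  obtain ⟨lam, hlam, -⟩ := hpos p₀ hp₀
  have hlampos : ∀ p ∈ S, 0 < lam p := by
    intro p hp
    obtain ⟨μ, hμ, hμp⟩ := hpos p hp
    rwa [hlam.eq_of_signIndependent hS hμ p hp]
  have hpair : ∀ k l, k ≠ l → ∑ p ∈ S, lam p * (bitSign (p k) * bitSign (p l)) = 0 := by
    intro k l hkl
    obtain ⟨μ, hμ, hμs⟩ := hfacet k 0
    obtain ⟨ν, hν, hνs⟩ := hfacet k 1
    have hprod : ∀ f : (ι → ZMod 2) → ℝ, ∑ p ∈ S, (μ p + ν p) / 2 * f p =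
        ((∑ p ∈ S, μ p * f p) + ∑ p ∈ S, ν p * f p) / 2 := by
      intro f
      rw [← sum_add_distrib, sum_div]
      exact sum_congr rfl (fun p _ => by ring)
    have hk : ∀ (w : (ι → ZMod 2) → ℝ) (b : ZMod 2) (f : (ι → ZMod 2) → ℝ),
        (∀ p ∈ S, w p ≠ 0 → p k = b) →
        ∑ p ∈ S, w p * (bitSign (p k) * f p) = bitSign b * ∑ p ∈ S, w p * f p := by
      intro w b f hw
      rw [mul_sum]
      refine sum_congr rfl (fun p hp => ?_)
      by_cases h0 : w p = 0
      · simp [h0]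
      · rw [hw p hp h0]
        ring
    have hbal : IsBalancedWeight S (fun _ => False) (fun p => (μ p + ν p) / 2) := by
      refine ⟨fun p hp => ?_, ?_, fun m _ => ?_⟩
      · have := hμ.nonneg p hp
        have := hν.nonneg p hp
        positivity
      · have := hprod (fun _ => 1)
        simp only [mul_one] at this
        rw [this, hμ.total, hν.total]
        norm_num
      · rw [hprod (fun p => bitSign (p m))]
        by_cases hmk : m = k
        · subst hmk
          have h1 := hk μ 0 (fun _ => 1) hμs
          have h2 := hk ν 1 (fun _ => 1) hνs
          simp only [mul_one] at h1 h2
          rw [h1, h2, hμ.total, hν.total]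
          simp
        · rw [hμ.mean m hmk, hν.mean m hmk]
          norm_num
    have heq := hlam.eq_of_signIndependent hS hbal
    rw [sum_congr rfl (fun p hp => by rw [heq p hp]),
      hprod (fun p => bitSign (p k) * bitSign (p l)),
      hk μ 0 _ hμs, hk ν 1 _ hνs, hμ.mean l hkl.symm, hν.mean l hkl.symm]
    norm_num
  rcases halt with ⟨l, hli, hlj, ε, hε⟩ | hfix
  · refine ⟨l, ε + 1, fun p hp => ?_⟩
    -- The sign product below is `1` when coordinate `i` is `1`, so its mean being zero forces it
    -- to be `-1` on the rest.
    have hnn : ∀ q ∈ S, 0 ≤ lam q * (bitSign ε * (bitSign (q l) * bitSign (q j)) +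
        bitSign (q i)) := by
      intro q hq
      refine mul_nonneg (hlampos q hq).le ?_
      rw [← bitSign_add, ← bitSign_add]
      rcases zmod_two_cases (q i) with h0 | h1
      · rw [h0]
        rcases zmod_two_cases (ε + (q l + q j)) with h | h <;> rw [h] <;> norm_num
      · rw [hε q hq h1, h1, show ε + (q j + ε + q j) = (ε + ε) + (q j + q j) by ring,
          CharTwo.add_self_eq_zero, CharTwo.add_self_eq_zero]
        norm_num
    have hsum : ∑ q ∈ S, lam q * (bitSign ε * (bitSign (q l) * bitSign (q j)) +
        bitSign (q i)) = 0 := by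
      simp only [mul_add, sum_add_distrib]
      rw [hlam.mean i id, add_zero]
      have := hpair l j hlj
      have h2 : ∑ q ∈ S, lam q * (bitSign ε * (bitSign (q l) * bitSign (q j))) =
          bitSign ε * ∑ q ∈ S, lam q * (bitSign (q l) * bitSign (q j)) := by
        rw [mul_sum]
        exact sum_congr rfl (fun q _ => by ring)
      rw [h2, this, mul_zero]
    have h0 := (sum_eq_zero_iff_of_nonneg hnn).1 hsum p hp
    have h1 := (mul_eq_zero.1 h0).resolve_left (hlampos p hp).ne'
    rw [← bitSign_add, ← bitSign_add] at h1
    have h2 : bitSign (ε + (p l + p j)) = bitSign (p i + 1) := by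
      rw [bitSign_add (p i) 1, bitSign_one]
      linarith
    have h3 := bitSign_injective h2
    have h4 : p l = ε + (p l + p j) + (ε + p j) := by
      rw [show ε + (p l + p j) + (ε + p j) = p l + ((ε + ε) + (p j + p j)) by ring,
        CharTwo.add_self_eq_zero, CharTwo.add_self_eq_zero, add_zero, add_zero]
    rw [h4, h3]
    ring
  · exfalso
    obtain ⟨a₀, a, ha⟩ := hS.exists_affine (fun p => bitSign (p i) * bitSign (p j))
    have hexp : ∀ (w f : (ι → ZMod 2) → ℝ),
        ∑ p ∈ S, w p * (f p * (bitSign (p i) * bitSign (p j))) =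
        a₀ * ∑ p ∈ S, w p * f p + ∑ l, a l * ∑ p ∈ S, w p * (f p * bitSign (p l)) := by
      intro w f
      simp only [mul_sum]
      rw [sum_comm, ← sum_add_distrib]
      refine sum_congr rfl (fun p hp => ?_)
      rw [ha p hp, mul_add, mul_add, mul_sum, mul_sum]
      congr 1
      · ring
      · exact sum_congr rfl (fun l _ => by ring)
    -- The coefficient at `j` is the mean of `sign i * sign j * sign j = sign i`, which is zero.
    have haj : a j = 0 := by
      have h1 := hexp lam (fun p => bitSign (p j))
      have h2 : ∀ p ∈ S, lam p * (bitSign (p j) * (bitSign (p i) * bitSign (p j))) =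
          lam p * bitSign (p i) := by
        intro p _
        rw [mul_comm (bitSign (p i)), ← mul_assoc (bitSign (p j)), bitSign_mul_self, one_mul]
      rw [sum_congr rfl h2, hlam.mean i id, hlam.mean j id, mul_zero, zero_add,
        sum_eq_single j] at h1
      · simp only [bitSign_mul_self, mul_one] at h1
        rw [hlam.total, mul_one] at h1
        exact h1.symm
      · intro l _ hl
        rw [hpair j l hl.symm, mul_zero]
      · simp
    -- Integrating the expansion against the weights that fix both coordinates leaves a right side
    -- independent of the bit `b` at `j`, whereas the left side changes sign with `b`.
    have hb : ∀ b, -bitSign b = a₀ - a i := by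
      intro b
      obtain ⟨μ, hμ, hsupp⟩ := hfix b
      have h1 := hexp μ (fun _ => 1)
      simp only [one_mul, mul_one] at h1
      rw [sum_mul_eq_of_support (c := -bitSign b) hμ.total, hμ.total, sum_eq_single i,
        sum_mul_eq_of_support (c := -1) hμ.total] at h1
      · rw [h1]
        ring
      · intro p hp hne
        rw [(hsupp p hp hne).1, bitSign_one]
      · intro l _ hl
        by_cases hlj : l = j
        · rw [hlj, haj, zero_mul]
        · rw [hμ.mean l (by simp [hl, hlj]), mul_zero]
      · simp
      · intro p hp hne
        rw [(hsupp p hp hne).1, (hsupp p hp hne).2, bitSign_one]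
        ring
    have h0 := hb 0
    have h1 := hb 1
    rw [← h0] at h1
    norm_num at h1

end BalancedPoints

/-! ### Cocycle spaces of projective geometries -/

section ProjectiveGeometry

variable {ι : Type*}

theorem mem_cocycleSpace_pgMatrix {k : ℕ} {x : {a : Fin k → ZMod 2 // a ≠ 0} → ZMod 2} :
    x ∈ cocycleSpace (pgMatrix k) ↔ ∃ y : Fin k → ZMod 2, ∀ a, x a = ∑ t, a.1 t * y t := by
  simp only [cocycleSpace, mem_image, mem_univ, true_and]
  refine exists_congr (fun y => ?_)
  rw [funext_iff]
  refine forall_congr' (fun a => ?_)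
  rw [eq_comm]
  rfl

theorem card_nonzero_vectors (k : ℕ) :
    Fintype.card {a : Fin k → ZMod 2 // a ≠ 0} + 1 = 2 ^ k := by
  have h := Fintype.card_subtype_compl (fun a : Fin k → ZMod 2 => a = 0)
  simp only [Fintype.card_unique, Fintype.card_pi, ZMod.card, prod_const, card_univ,
    Fintype.card_fin] at h
  have hpos : 0 < 2 ^ k := by positivity
  change Fintype.card {a : Fin k → ZMod 2 // ¬ a = 0} + 1 = _
  omega

/-- If the coordinates are closed under sums up to constants, then after a twist by a point of `S`
the coordinate functions are all the nonzero elements of a space of functions over `GF(2)`. A basis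
of this space identifies `S` with a cocycle space, as `S` has enough points. -/
theorem pointsIsomorphic_cocycleSpace [Fintype ι] [Nonempty ι] {S : Finset (ι → ZMod 2)}
    (hfacet : HasFacetCenters S)
    (hclosed : ∀ i j, i ≠ j → ∃ l c, ∀ p ∈ S, p l = p i + p j + c) :
    ∃ k, 1 ≤ k ∧ PointsIsomorphic S (cocycleSpace (pgMatrix k)) := by
  classical
  obtain ⟨i₀⟩ := ‹Nonempty ι›
  obtain ⟨p₀, hp₀, -⟩ := hfacet.exists_apply_eq i₀ 0
  let x : ι → (S → ZMod 2) := fun i p => (p : ι → ZMod 2) i + p₀ i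
  have hx0 : ∀ i, x i ≠ 0 := by
    intro i h0
    obtain ⟨p, hp, hpi⟩ := hfacet.exists_apply_eq i (p₀ i + 1)
    have := congrFun h0 ⟨p, hp⟩
    simp only [x, hpi, Pi.zero_apply] at this
    rw [show p₀ i + 1 + p₀ i = (p₀ i + p₀ i) + 1 by ring, CharTwo.add_self_eq_zero] at this
    exact absurd this (by decide)
  have hxinj : Function.Injective x := by
    intro i j hij
    refine (hfacet.eq_of_add_const (c := p₀ i + p₀ j) (fun p hp => ?_)).symm
    have := congrFun hij ⟨p, hp⟩
    simp only [x] at this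
    calc p j = p j + p₀ j + p₀ j := by rw [add_assoc, CharTwo.add_self_eq_zero, add_zero]
      _ = p i + (p₀ i + p₀ j) := by rw [← this, add_assoc]
  have hxadd : ∀ i j, i ≠ j → ∃ l, x l = x i + x j := by
    intro i j hij
    obtain ⟨l, c, hl⟩ := hclosed i j hij
    refine ⟨l, funext (fun p => ?_)⟩
    simp only [x, Pi.add_apply]
    rw [hl p p.2, hl p₀ hp₀]
    calc _ = (p : ι → ZMod 2) i + p₀ i + ((p : ι → ZMod 2) j + p₀ j) + (c + c) := by ring
      _ = _ := by rw [CharTwo.add_self_eq_zero, add_zero]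
  let W : Submodule (ZMod 2) (S → ZMod 2) :=
    { carrier := {f | f = 0 ∨ ∃ i, x i = f}
      zero_mem' := Or.inl rfl
      add_mem' := by
        rintro f g (rfl | ⟨i, rfl⟩) (rfl | ⟨j, rfl⟩)
        · exact Or.inl (add_zero 0)
        · exact Or.inr ⟨j, (zero_add _).symm⟩
        · exact Or.inr ⟨i, (add_zero _).symm⟩
        · by_cases hij : i = j
          · subst hij
            left
            funext p
            exact CharTwo.add_self_eq_zero (x i p)
          · exact Or.inr (hxadd i j hij)
      smul_mem' := by
        intro c f hf
        rcases zmod_two_cases c with rfl | rfl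
        · exact Or.inl (zero_smul _ _)
        · rwa [one_smul] }
  let b := Module.finBasis (ZMod 2) W
  have hxW : ∀ i, x i ∈ W := fun i => Or.inr ⟨i, rfl⟩
  let e₀ : ι → {a : Fin (Module.finrank (ZMod 2) W) → ZMod 2 // a ≠ 0} := fun i =>
    ⟨b.equivFun ⟨x i, hxW i⟩, fun h => hx0 i (by
      have := b.equivFun.map_eq_zero_iff.1 h
      exact congrArg Subtype.val this)⟩
  have he₀ : Function.Bijective e₀ := by
    constructor
    · intro i j hij
      have h1 : b.equivFun ⟨x i, hxW i⟩ = b.equivFun ⟨x j, hxW j⟩ := congrArg Subtype.val hij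
      exact hxinj (congrArg Subtype.val (b.equivFun.injective h1))
    · rintro ⟨a, ha⟩
      obtain ⟨w, rfl⟩ := b.equivFun.surjective a
      have hw : w ≠ 0 := fun h => ha (by rw [h, map_zero])
      rcases w.2 with h | ⟨i, hi⟩
      · exact absurd (Subtype.ext h) hw
      · refine ⟨i, Subtype.ext ?_⟩
        change b.equivFun ⟨x i, hxW i⟩ = b.equivFun w
        congr 1
        exact Subtype.ext hi
  let e := Equiv.ofBijective e₀ he₀
  have hcard := Fintype.card_congr e
  have hcardS := hfacet.card_lt_card
  refine ⟨Module.finrank (ZMod 2) W, ?_, e, fun a => p₀ (e.symm a), ?_⟩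
  · by_contra hlt
    have h0 := card_nonzero_vectors (Module.finrank (ZMod 2) W)
    rw [show Module.finrank (ZMod 2) W = 0 by omega, pow_zero] at h0
    have h1 : 0 < Fintype.card ι := Fintype.card_pos_iff.2 ⟨i₀⟩
    rw [hcard] at h1
    rw [show Module.finrank (ZMod 2) W = 0 by omega] at h1
    omega
  · symm
    apply eq_of_subset_of_card_le
    · intro z hz
      obtain ⟨p, hp, rfl⟩ := mem_image.1 hz
      rw [mem_cocycleSpace_pgMatrix]
      refine ⟨fun t => (b t : S → ZMod 2) ⟨p, hp⟩, fun a => ?_⟩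
      obtain ⟨i, rfl⟩ := e.surjective a
      have h1 := congrArg Subtype.val (b.sum_equivFun ⟨x i, hxW i⟩)
      have h2 := congrFun h1 ⟨p, hp⟩
      change _ = x i ⟨p, hp⟩ at h2
      rw [show p (e.symm (e i)) + p₀ (e.symm (e i)) = x i ⟨p, hp⟩ by
        rw [Equiv.symm_apply_apply], ← h2]
      rw [Submodule.coe_sum, Finset.sum_apply]
      rfl
    · rw [card_image_of_injective]
      · calc (cocycleSpace (pgMatrix (Module.finrank (ZMod 2) W))).card
            ≤ (univ : Finset (Fin (Module.finrank (ZMod 2) W) → ZMod 2)).card := card_image_le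
          _ = 2 ^ Module.finrank (ZMod 2) W := by simp
          _ = Fintype.card ι + 1 := by rw [← card_nonzero_vectors, hcard]
          _ ≤ S.card := hcardS
      · intro p q hpq
        funext i
        have := congrFun hpq (e i)
        simpa using this

/-- Orthogonality of characters: the sum of `(-1)^⟨a, z⟩` over all `a` vanishes for `z ≠ 0`. -/
theorem sum_bitSign_eq_zero {k : ℕ} {z : Fin k → ZMod 2} (hz : z ≠ 0) :
    ∑ a : Fin k → ZMod 2, bitSign (∑ t, a t * z t) = 0 := by
  obtain ⟨t₀, ht₀⟩ := Function.ne_iff.1 hz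
  have hz1 : z t₀ = 1 := (zmod_two_cases _).resolve_left ht₀
  have h := Equiv.sum_comp (Equiv.addRight (Pi.single t₀ (1 : ZMod 2)))
    (fun a : Fin k → ZMod 2 => bitSign (∑ t, a t * z t))
  have h2 : ∀ a : Fin k → ZMod 2, bitSign (∑ t, (Equiv.addRight (Pi.single t₀ (1 : ZMod 2)) a) t *
      z t) = -bitSign (∑ t, a t * z t) := by
    intro a
    simp only [Equiv.coe_addRight, Pi.add_apply, add_mul, sum_add_distrib]
    rw [bitSign_add, show ∑ t, (Pi.single t₀ (1 : ZMod 2) : Fin k → ZMod 2) t * z t = 1 by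
      rw [sum_eq_single t₀]
      · simp [hz1]
      · intro t _ ht
        simp [ht]
      · simp]
    simp
  simp only [h2, sum_neg_distrib] at h
  linarith

/-- Fourier inversion recovers weights on a cocycle space of a projective geometry from their
coordinate sums. -/
theorem signIndependent_of_pointsIsomorphic [Fintype ι] {S : Finset (ι → ZMod 2)} {k : ℕ}
    (h : PointsIsomorphic S (cocycleSpace (pgMatrix k))) : SignIndependent S := by
  obtain ⟨e, q, he⟩ := h
  have hy : ∀ p : ι → ZMod 2, ∃ y : Fin k → ZMod 2, p ∈ S → ∀ a : {a : Fin k → ZMod 2 // a ≠ 0},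
      p (e.symm a) + q a = ∑ t, a.1 t * y t := by
    intro p
    by_cases hp : p ∈ S
    · have : (fun j => p (e.symm j) + q j) ∈ cocycleSpace (pgMatrix k) := by
        rw [he]
        exact mem_image_of_mem (fun (p : ι → ZMod 2) j => p (e.symm j) + q j) hp
      obtain ⟨y, hy⟩ := mem_cocycleSpace_pgMatrix.1 this
      exact ⟨y, fun _ => hy⟩
    · exact ⟨0, fun h => absurd h hp⟩
  choose y hy using hy
  have hyinj : ∀ p ∈ S, ∀ p' ∈ S, y p = y p' → p = p' := by
    intro p hp p' hp' heq
    funext i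
    have h1 := hy p hp (e i)
    have h2 := hy p' hp' (e i)
    rw [heq, ← h2, Equiv.symm_apply_apply] at h1
    exact add_right_cancel h1
  intro f hf hfs p' hp'
  have hchar : ∀ a : Fin k → ZMod 2, ∑ p ∈ S, f p * bitSign (∑ t, a t * y p t) = 0 := by
    intro a
    by_cases ha : a = 0
    · subst ha
      simpa using hf
    · have h1 : ∀ p ∈ S, f p * bitSign (∑ t, a t * y p t) =
          bitSign (q ⟨a, ha⟩) * (f p * bitSign (p (e.symm ⟨a, ha⟩))) := by
        intro p hp
        rw [← hy p hp ⟨a, ha⟩, bitSign_add]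
        ring
      rw [sum_congr rfl h1, ← mul_sum, hfs, mul_zero]
  have hzero : ∑ a : Fin k → ZMod 2, bitSign (∑ t, a t * y p' t) *
      ∑ p ∈ S, f p * bitSign (∑ t, a t * y p t) = 0 :=
    sum_eq_zero (fun a _ => by rw [hchar a, mul_zero])
  have hswap : ∑ a : Fin k → ZMod 2, bitSign (∑ t, a t * y p' t) *
      ∑ p ∈ S, f p * bitSign (∑ t, a t * y p t) =
      ∑ p ∈ S, f p * ∑ a : Fin k → ZMod 2, bitSign (∑ t, a t * (y p' + y p) t) := by
    simp only [mul_sum]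
    rw [sum_comm]
    refine sum_congr rfl (fun p _ => sum_congr rfl (fun a _ => ?_))
    simp only [Pi.add_apply, mul_add, sum_add_distrib, bitSign_add]
    ring
  rw [hswap, sum_eq_single p'] at hzero
  · have hpp : y p' + y p' = 0 := by
      funext t
      exact CharTwo.add_self_eq_zero _
    rw [hpp] at hzero
    simpa using hzero
  · intro p hp hne
    rw [sum_bitSign_eq_zero, mul_zero]
    intro h0
    refine hne (hyinj p hp p' hp' ?_)
    funext t
    have := congrFun h0 t
    simp only [Pi.add_apply, Pi.zero_apply] at this
    exact (CharTwo.add_eq_zero.1 this).symm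
  · exact fun h => absurd hp' h

end ProjectiveGeometry

/-! ### Setcores -/

namespace Clutter

section Setcore

variable {α : Type*} [DecidableEq α]

theorem IsTangled.isPretangled {C : Clutter α} (h : C.IsTangled) : C.IsPretangled where
  exists_pair v hv := by
    obtain ⟨B, ⟨hB, hBc⟩, hvB⟩ := h.2 v hv
    rw [h.1] at hBc
    obtain ⟨x, y, -, rfl⟩ := card_eq_two.1 hBc
    simp only [mem_insert, mem_singleton] at hvB
    rcases hvB with rfl | rfl
    · exact ⟨y, hB⟩
    · exact ⟨x, isCover_pair_symm hB⟩
  two_le_card B hB := by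
    rw [← h.1]
    exact Nat.sInf_le ⟨B, hB, rfl⟩

theorem IsTangled.ground_nonempty {C : Clutter α} (h : C.IsTangled) : C.ground.Nonempty := by
  have hpos : 0 < C.coveringNumber := by
    rw [h.1]
    exact two_pos
  obtain ⟨B, hB, hBc⟩ := Nat.sInf_mem (Nat.nonempty_of_pos_sInf hpos)
  have : 0 < B.card := by
    rw [hBc]
    exact hpos
  exact (card_pos.1 this).mono hB.1

theorem IsTangled.reachable_iff_conn {C : Clutter α} (h : C.IsTangled) (u v : C.ground) :
    C.coverGraph.Reachable u v ↔ C.Conn u v := by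
  constructor
  · rintro ⟨w⟩
    induction w with
    | nil => exact Relation.ReflTransGen.refl
    | cons hadj _ ih => exact Relation.ReflTransGen.head hadj.2.1 ih
  · intro hconn
    have key : ∀ x, C.Conn u x → ∀ hx : x ∈ C.ground, C.coverGraph.Reachable u ⟨x, hx⟩ := by
      intro x hux
      induction hux with
      | refl => exact fun _ => SimpleGraph.Reachable.refl _
      | @tail y z _ hyz ih =>
        intro hz
        have hy : y ∈ C.ground := hyz.1 (by simp)
        have hcard := h.isPretangled.two_le_card _ hyz
        refine (ih hy).trans (SimpleGraph.Adj.reachable ⟨?_, hyz, ?_⟩)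
        · intro heq
          have : y = z := congrArg Subtype.val heq
          rw [this, pair_eq_singleton, card_singleton] at hcard
          omega
        · rw [h.1]
          exact le_antisymm (card_le_two) hcard
    exact key v hconn v.2

/-- Every clean tangled clutter has a setcore. Fix a core member `A₀`. An element is sent to the
pair of its component and the bit telling whether it lies in `A₀`. -/
theorem exists_isSetcore {C : Clutter α} (hC : C.IsClean) (hT : C.IsTangled) :
    ∃ S, C.IsSetcore S := by
  classical
  have hP := hT.isPretangled
  obtain ⟨v₀, hv₀⟩ := hT.ground_nonempty
  obtain ⟨y, hy⟩ := exists_isPackingTwo hC hP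
  obtain ⟨A₀, hA₀, hyA₀⟩ : ∃ A ∈ C.members, y A ≠ 0 := by
    by_contra hcon
    push Not at hcon
    have := hy.2
    rw [packingValue, sum_eq_zero hcon] at this
    norm_num at this
  have hA₀core := (hy.isBalancedOutside hP).core A₀ hA₀ hyA₀
  let eqv : C.coverGraph.ConnectedComponent ≃ Fin C.rank := Finite.equivFin _
  let σ : α → C.ground := fun v => if h : v ∈ C.ground then ⟨v, h⟩ else ⟨v₀, hv₀⟩
  have hσ : ∀ v ∈ C.ground, (σ v : α) = v := fun v hv => by simp [σ, hv]
  let idx : α → Fin C.rank := fun v => eqv (C.coverGraph.connectedComponentMk (σ v))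
  have hidx : ∀ u ∈ C.ground, ∀ v ∈ C.ground, idx u = idx v ↔ C.Conn u v := by
    intro u hu v hv
    rw [← hσ u hu, ← hσ v hv, ← hT.reachable_iff_conn, ← SimpleGraph.ConnectedComponent.eq]
    simp only [idx, hσ u hu, hσ v hv, EmbeddingLike.apply_eq_iff_eq]
  have hidxsurj : ∀ i, ∃ v ∈ C.ground, idx v = i := by
    intro i
    obtain ⟨c, rfl⟩ := eqv.surjective i
    induction c using SimpleGraph.ConnectedComponent.ind with
    | _ v =>
      refine ⟨v, v.2, ?_⟩
      have : σ v = v := Subtype.ext (hσ v v.2)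
      simp only [idx, this]
  have hrep : ∀ i, ∀ b : Prop, ∃ v ∈ C.ground, idx v = i ∧ (v ∈ A₀ ↔ b) := by
    intro i b
    obtain ⟨v, hv, rfl⟩ := hidxsurj i
    obtain ⟨u, huv⟩ := hP.exists_pair v hv
    have hug : u ∈ C.ground := huv.1 (by simp)
    have hx := mem_iff_notMem_of_mem_core huv hA₀core
    have hiu : idx u = idx v :=
      (hidx u hug v hv).2 (Relation.ReflTransGen.single (isCover_pair_symm huv))
    by_cases hvb : v ∈ A₀ ↔ b
    · exact ⟨v, hv, rfl, hvb⟩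
    · exact ⟨u, hug, hiu, by tauto⟩
  choose rep hrepg hrepi hrepA using fun i => hrep i True
  let φ : α → Fin C.rank × ZMod 2 := fun v => (idx v, if v ∈ A₀ then 1 else 0)
  let pt : Finset α → (Fin C.rank → ZMod 2) := fun A i => if rep i ∈ A then 1 else 0
  refine ⟨C.core.members.image pt, φ, ?_, ?_⟩
  · ext ⟨i, b⟩
    refine iff_of_true (mem_image.2 ?_) (mem_univ _)
    obtain ⟨v, hv, hvi, hvb⟩ := hrep i (b = 1)
    refine ⟨v, hv, Prod.ext hvi ?_⟩
    rcases zmod_two_cases b with rfl | rfl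
    · simp only [φ]
      exact if_neg (fun hmem => absurd (hvb.1 hmem) (by decide))
    · simp only [φ]
      exact if_pos (hvb.2 rfl)
  · change C.core.members = ((C.core.members.image pt).image _).image _
    rw [image_image, image_image]
    symm
    rw [image_congr (g := id), image_id]
    intro A hA
    simp only [Function.comp_apply, id_eq]
    ext v
    rw [mem_filter]
    have hAg : A ⊆ C.ground := C.core.subset_ground A hA
    refine ⟨fun ⟨hv, hmem⟩ => ?_, fun hvA => ⟨hAg hvA, ?_⟩⟩
    · obtain ⟨i, -, hi⟩ := mem_image.1 hmem
      have hvi : i = idx v := congrArg Prod.fst hi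
      have hb : pt A i = if v ∈ A₀ then 1 else 0 := congrArg Prod.snd hi
      have hconn : C.Conn v (rep i) := (hidx v hv _ (hrepg i)).1 (by rw [hrepi, hvi])
      have hr := hrepA i
      rcases hconn.agree_or_disagree with h | h
      · have h1 := h A hA
        have h2 := h A₀ hA₀core
        simp only [pt] at hb
        split_ifs at hb <;> simp_all
      · have h1 := h A hA
        have h2 := h A₀ hA₀core
        simp only [pt] at hb
        split_ifs at hb <;> simp_all
    · refine mem_image.2 ⟨idx v, mem_univ _, Prod.ext rfl ?_⟩
      change pt A (idx v) = if v ∈ A₀ then 1 else 0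
      have hconn : C.Conn v (rep (idx v)) := (hidx v (hAg hvA) _ (hrepg _)).1 (hrepi _).symm
      have hr := hrepA (idx v)
      simp only [pt]
      rcases hconn.agree_or_disagree with h | h
      · have h1 := h A hA
        have h2 := h A₀ hA₀core
        split_ifs <;> simp_all
      · have h1 := h A hA
        have h2 := h A₀ hA₀core
        split_ifs <;> simp_all

/-- A coordinatization of the core by `S`: `coord v` is the element of the cuboid that `v` is a copy
of, and `member p` is the core member given by the point `p`. -/
structure CoreCoordinates (C : Clutter α) {r : ℕ} (S : Finset (Fin r → ZMod 2)) where
  coord : α → Fin r × ZMod 2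
  member : (Fin r → ZMod 2) → Finset α
  exists_coord : ∀ x, ∃ v ∈ C.ground, coord v = x
  mem_member : ∀ p, ∀ v ∈ C.ground, v ∈ member p ↔ p (coord v).1 = (coord v).2
  core_members : C.core.members = S.image member

theorem IsSetcore.nonempty_coreCoordinates {C : Clutter α} {S : Finset (Fin C.rank → ZMod 2)}
    (h : C.IsSetcore S) : Nonempty (C.CoreCoordinates S) := by
  obtain ⟨φ, hφ, hm⟩ := h
  refine ⟨⟨φ, fun p => C.core.ground.filter (fun v => φ v ∈ univ.image (fun i => (i, p i))),
    fun x => ?_, fun p v hv => ?_, ?_⟩⟩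
  · have : x ∈ C.core.ground.image φ := by
      rw [hφ]
      exact mem_univ x
    exact mem_image.1 this
  · rw [mem_filter, mem_image]
    refine ⟨fun ⟨_, i, _, hi⟩ => ?_, fun hp => ⟨hv, (φ v).1, mem_univ _, Prod.ext rfl hp⟩⟩
    rw [← hi]
  · rw [hm]
    exact image_image

namespace CoreCoordinates

variable {C : Clutter α} {r : ℕ} {S : Finset (Fin r → ZMod 2)}

theorem member_injective (D : C.CoreCoordinates S) : Function.Injective D.member := by
  intro p q hpq
  funext i
  obtain ⟨v, hv, hvx⟩ := D.exists_coord (i, p i)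
  have h1 := D.mem_member p v hv
  have h2 := D.mem_member q v hv
  rw [hvx] at h1 h2
  exact (h2.1 (hpq ▸ h1.2 rfl)).symm

theorem member_mem_core (D : C.CoreCoordinates S) {p : Fin r → ZMod 2} (hp : p ∈ S) :
    D.member p ∈ C.core.members := by
  rw [D.core_members]
  exact mem_image_of_mem _ hp

theorem member_mem_members (D : C.CoreCoordinates S) {p : Fin r → ZMod 2} (hp : p ∈ S) :
    D.member p ∈ C.members :=
  (mem_core_iff.1 (D.member_mem_core hp)).1

theorem sum_members (D : C.CoreCoordinates S) {y : Finset α → ℝ} {T : α → Prop}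
    (hy : C.IsBalancedOutside y T) (g : Finset α → ℝ) :
    ∑ A ∈ C.members, y A * g A = ∑ p ∈ S, y (D.member p) * g (D.member p) := by
  rw [← sum_image (g := D.member) (f := fun A => y A * g A) (fun p _ q _ h => D.member_injective h),
    ← D.core_members]
  symm
  refine sum_subset (fun A hA => (mem_core_iff.1 hA).1) (fun A hA hAc => ?_)
  have : y A = 0 := by
    by_contra hne
    exact hAc (hy.core A hA hne)
  rw [this, zero_mul]

/-- Balanced weights on the core members, halved, are balanced probability weights on `S`. -/
theorem isBalancedWeight (D : C.CoreCoordinates S) {y : Finset α → ℝ} {T : α → Prop}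
    (hy : C.IsBalancedOutside y T) {T' : Fin r → Prop}
    (hT : ∀ j, ¬ T' j → ∃ v ∈ C.ground, (D.coord v).1 = j ∧ ¬ T v) :
    IsBalancedWeight S T' (fun p => y (D.member p) / 2) where
  nonneg p hp := by
    have := hy.nonneg _ (D.member_mem_members hp)
    positivity
  total := by
    have := D.sum_members hy (fun _ => 1)
    simp only [mul_one] at this
    rw [← sum_div, ← this, hy.value]
    norm_num
  mean j hj := by
    obtain ⟨v, hv, rfl, hvT⟩ := hT j hj
    have h1 := hy.sum_eq_one v hv hvT
    rw [sum_filter_mem_eq_sum_mul, D.sum_members hy] at h1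
    have h2 := D.sum_members hy (fun _ => 1)
    simp only [mul_one] at h2
    rw [hy.value] at h2
    have h3 : ∀ p ∈ S, y (D.member p) / 2 * bitSign (p (D.coord v).1) =
        bitSign (D.coord v).2 * (y (D.member p) * (if v ∈ D.member p then 1 else 0) -
          y (D.member p) / 2) := by
      intro p _
      have h4 := D.mem_member p v hv
      by_cases hp : p (D.coord v).1 = (D.coord v).2
      · rw [if_pos (h4.2 hp), hp]
        ring
      · rw [if_neg (fun h => hp (h4.1 h))]
        have h5 : bitSign (p (D.coord v).1) = -bitSign (D.coord v).2 := by
          rcases zmod_two_cases (p (D.coord v).1) with h | h <;>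
            rcases zmod_two_cases (D.coord v).2 with h' | h' <;> simp_all
        rw [h5]
        ring
    rw [sum_congr rfl h3, ← mul_sum, sum_sub_distrib, h1, ← sum_div, ← h2]
    norm_num

theorem conn_of_coord_eq (D : C.CoreCoordinates S) (hC : C.IsClean) (hP : C.IsPretangled) {u v : α}
    (hu : u ∈ C.ground) (hv : v ∈ C.ground) (h : (D.coord u).1 = (D.coord v).1) : C.Conn v u := by
  by_contra hcon
  obtain ⟨y, hy, hyv⟩ := exists_isBalancedOutside hC hP hv True
  have h1 := hy.sum_eq_one u hu hcon
  have h2 := hy.value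
  rw [sum_filter_mem_eq_sum_mul] at h1
  have key : ∀ A ∈ C.members, y A ≠ 0 → (u ∈ A ↔ (D.coord v).2 = (D.coord u).2) := by
    intro A hA hne
    have hvA := (hyv A hA hne).2 trivial
    have hAc := hy.core A hA hne
    rw [D.core_members] at hAc
    obtain ⟨p, -, rfl⟩ := mem_image.1 hAc
    rw [D.mem_member p u hu, h, (D.mem_member p v hv).1 hvA]
  have h3 : ∀ A ∈ C.members, y A * (if u ∈ A then 1 else 0) =
      y A * (if (D.coord v).2 = (D.coord u).2 then 1 else 0) := by
    intro A hA
    by_cases hne : y A = 0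
    · rw [hne, zero_mul, zero_mul]
    · simp only [key A hA hne]
  rw [sum_congr rfl h3, ← sum_mul, h2] at h1
  split_ifs at h1 <;> norm_num at h1

end CoreCoordinates

/-- As there are as many coordinates as components, distinct coordinates belong to distinct
components. -/
theorem CoreCoordinates.coord_eq_of_conn {C : Clutter α} {S : Finset (Fin C.rank → ZMod 2)}
    (D : C.CoreCoordinates S) (hC : C.IsClean) (hT : C.IsTangled) {u v : α}
    (hu : u ∈ C.ground) (hv : v ∈ C.ground) (h : C.Conn v u) :
    (D.coord u).1 = (D.coord v).1 := by
  classical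
  have hP := hT.isPretangled
  choose rep hrep hrepc using fun i : Fin C.rank => D.exists_coord (i, 0)
  let f : Fin C.rank → C.coverGraph.ConnectedComponent := fun i =>
    C.coverGraph.connectedComponentMk ⟨rep i, hrep i⟩
  have hf : ∀ w (hw : w ∈ C.ground), f (D.coord w).1 =
      C.coverGraph.connectedComponentMk ⟨w, hw⟩ := by
    intro w hw
    rw [SimpleGraph.ConnectedComponent.eq, hT.reachable_iff_conn]
    exact D.conn_of_coord_eq hC hP hw (hrep _) (by rw [hrepc])
  have hsurj : Function.Surjective f := by
    intro c
    induction c using SimpleGraph.ConnectedComponent.ind with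
    | _ w => exact ⟨_, hf w w.2⟩
  have hbij := hsurj.bijective_of_nat_card_le (by rw [Nat.card_fin]; exact le_rfl)
  apply hbij.1
  rw [hf u hu, hf v hv, SimpleGraph.ConnectedComponent.eq, hT.reachable_iff_conn]
  exact h.symm

theorem IsPackingTwo.eq_of_signIndependent {C : Clutter α} (hP : C.IsPretangled) {r : ℕ}
    {S : Finset (Fin r → ZMod 2)} (D : C.CoreCoordinates S) (hS : SignIndependent S)
    {y y' : Finset α → ℝ} (hy : C.IsPackingTwo y) (hy' : C.IsPackingTwo y') :
    ∀ A ∈ C.members, y A = y' A := by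
  intro A hA
  have hb := hy.isBalancedOutside hP
  have hb' := hy'.isBalancedOutside hP
  by_cases hAc : A ∈ C.core.members
  · have hT : ∀ j, ¬ False → ∃ v ∈ C.ground, (D.coord v).1 = j ∧ ¬ False := by
      intro j _
      obtain ⟨v, hv, hvj⟩ := D.exists_coord (j, 0)
      exact ⟨v, hv, by rw [hvj], id⟩
    rw [D.core_members] at hAc
    obtain ⟨p, hp, rfl⟩ := mem_image.1 hAc
    have := (D.isBalancedWeight hb hT).eq_of_signIndependent hS (D.isBalancedWeight hb' hT) p hp
    linarith
  · have h0 : y A = 0 := by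
      by_contra hne
      exact hAc (hb.core A hA hne)
    have h0' : y' A = 0 := by
      by_contra hne
      exact hAc (hb'.core A hA hne)
    rw [h0, h0']

theorem CoreCoordinates.hasFacetCenters {C : Clutter α} {S : Finset (Fin C.rank → ZMod 2)}
    (D : C.CoreCoordinates S) (hC : C.IsClean) (hT : C.IsTangled) : HasFacetCenters S := by
  intro i b
  obtain ⟨v, hv, hvi⟩ := D.exists_coord (i, 1)
  obtain ⟨y, hy, hyv⟩ := exists_isBalancedOutside hC hT.isPretangled hv (b = 1)
  refine ⟨_, D.isBalancedWeight hy (fun j hj => ?_), fun p hp hne => ?_⟩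
  · obtain ⟨u, hu, huj⟩ := D.exists_coord (j, 0)
    refine ⟨u, hu, by rw [huj], fun hconn => hj ?_⟩
    have := D.coord_eq_of_conn hC hT hu hv hconn
    rwa [huj, hvi] at this
  · have h1 := hyv _ (D.member_mem_members hp) (fun h0 => hne (by simp only [h0, zero_div]))
    rw [D.mem_member p v hv, hvi] at h1
    rcases zmod_two_cases (p i) with h | h <;> rcases zmod_two_cases b with h' | h' <;> simp_all

theorem CoreCoordinates.exists_isBalancedWeight_pos {C : Clutter α}
    {S : Finset (Fin C.rank → ZMod 2)} (D : C.CoreCoordinates S) (hP : C.IsPretangled)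
    {p : Fin C.rank → ZMod 2} (hp : p ∈ S) :
    ∃ μ, IsBalancedWeight S (fun _ => False) μ ∧ 0 < μ p := by
  obtain ⟨-, y, hy, hpos⟩ := mem_core_iff.1 (D.member_mem_core hp)
  refine ⟨_, D.isBalancedWeight (hy.isBalancedOutside hP) (fun j _ => ?_), ?_⟩
  · obtain ⟨v, hv, hvj⟩ := D.exists_coord (j, 0)
    exact ⟨v, hv, by rw [hvj], id⟩
  · positivity

theorem CoreCoordinates.merge_or_exists_isBalancedWeight {C : Clutter α}
    {S : Finset (Fin C.rank → ZMod 2)} (D : C.CoreCoordinates S) (hC : C.IsClean)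
    (hT : C.IsTangled) (hS : SignIndependent S) {i j : Fin C.rank} (hij : i ≠ j) :
    (∃ l, l ≠ i ∧ l ≠ j ∧ ∃ ε, ∀ p ∈ S, p i = 1 → p l = p j + ε) ∨
      ∀ b, ∃ μ, IsBalancedWeight S (fun l => l = i ∨ l = j) μ ∧
        ∀ p ∈ S, μ p ≠ 0 → p i = 1 ∧ p j = b := by
  have hP := hT.isPretangled
  obtain ⟨v, hv, hvi⟩ := D.exists_coord (i, 1)
  obtain ⟨w, hw, hwj⟩ := D.exists_coord (j, 1)
  have hvw : ¬ C.Conn v w := by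
    intro hconn
    have := D.coord_eq_of_conn hC hT hw hv hconn
    rw [hvi, hwj] at this
    exact hij this.symm
  rcases merge_or_exists_isBalancedOutside hC hP
    (fun y y' hy hy' => hy.eq_of_signIndependent hP D hS hy') hv hw hvw with
    ⟨u, hu, hvu, hwu, halt⟩ | hbal
  · left
    refine ⟨(D.coord u).1, fun h => hvu (D.conn_of_coord_eq hC hP hu hv (by rw [hvi, h])),
      fun h => hwu (D.conn_of_coord_eq hC hP hu hw (by rw [hwj, h])), ?_⟩
    have hmem : ∀ p, (v ∈ D.member p ↔ p i = 1) ∧ (w ∈ D.member p ↔ p j = 1) ∧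
        (u ∈ D.member p ↔ p (D.coord u).1 = (D.coord u).2) := by
      intro p
      refine ⟨?_, ?_, D.mem_member p u hu⟩
      · rw [D.mem_member p v hv, hvi]
      · rw [D.mem_member p w hw, hwj]
    have hcases : ∀ x y c : ZMod 2, ((x = c ↔ y = 1) → x = y + (c + 1)) ∧
        ((x = c ↔ ¬ y = 1) → x = y + c) := by decide
    rcases halt with h | h
    · refine ⟨(D.coord u).2 + 1, fun p hp hpi => (hcases _ _ _).1 ?_⟩
      have := h _ (D.member_mem_core hp) ((hmem p).1.2 hpi)
      rwa [(hmem p).2.1, (hmem p).2.2] at this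
    · refine ⟨(D.coord u).2, fun p hp hpi => (hcases _ _ _).2 ?_⟩
      have := h _ (D.member_mem_core hp) ((hmem p).1.2 hpi)
      rwa [(hmem p).2.1, (hmem p).2.2] at this
  · right
    intro b
    obtain ⟨y, hy, hyvw⟩ := hbal (b = 1)
    refine ⟨_, D.isBalancedWeight hy (fun l hl => ?_), fun p hp hne => ?_⟩
    · rw [not_or] at hl
      obtain ⟨u, hu, hul⟩ := D.exists_coord (l, 0)
      refine ⟨u, hu, by rw [hul], ?_⟩
      rintro (hconn | hconn)
      · have := D.coord_eq_of_conn hC hT hu hv hconn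
        rw [hul, hvi] at this
        exact hl.1 this
      · have := D.coord_eq_of_conn hC hT hu hw hconn
        rw [hul, hwj] at this
        exact hl.2 this
    · obtain ⟨h1, h2⟩ := hyvw _ (D.member_mem_members hp)
        (fun h0 => hne (by simp only [h0, zero_div]))
      rw [D.mem_member p v hv, hvi] at h1
      rw [D.mem_member p w hw, hwj] at h2
      refine ⟨h1, ?_⟩
      rcases zmod_two_cases (p j) with h | h <;> rcases zmod_two_cases b with h' | h' <;> simp_all

end Setcore

end Clutter

theorem mainTheorem1 {α : Type*} [DecidableEq α] (C : Clutter α)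
    (hclean : C.IsClean) (htangled : C.IsTangled) :
    (∃ S : Finset (Fin C.rank → ZMod 2), C.IsSetcore S) ∧
    ∀ S : Finset (Fin C.rank → ZMod 2), C.IsSetcore S →
      (IsSimplex (convPoints S) ↔
        ∃ k : ℕ, 1 ≤ k ∧ PointsIsomorphic S (cocycleSpace (pgMatrix k))) := by
  refine ⟨Clutter.exists_isSetcore hclean htangled, fun S hS => ?_⟩
  obtain ⟨D⟩ := hS.nonempty_coreCoordinates
  have hfacet := D.hasFacetCenters hclean htangled
  obtain ⟨v, hv⟩ := htangled.ground_nonempty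
  have : Nonempty (Fin C.rank) := ⟨(D.coord v).1⟩
  constructor
  · intro hsimplex
    have hind := SignIndependent.of_isSimplex hsimplex
    exact pointsIsomorphic_cocycleSpace hfacet (fun i j hij =>
      exists_eq_add_of_signIndependent hind hfacet
        (fun p hp => D.exists_isBalancedWeight_pos htangled.isPretangled hp)
        (D.merge_or_exists_isBalancedWeight hclean htangled hind hij))
  · rintro ⟨k, -, hk⟩
    obtain ⟨p, hp, -⟩ := hfacet.exists_apply_eq (D.coord v).1 0
    exact (signIndependent_of_pointsIsomorphic hk).isSimplex ⟨p, hp⟩
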